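/- Let $F$ be a non-archimedean local field of characteristic $0$, with ring of integers $\mathcal O$, maximal ideal $\mathfrak p=\varpi\mathcal O$ ($\varpi$ any uniformizer) and residue field $k=\mathcal O/\mathfrak p$ (of arbitrary characteristic, $2$ included). Let $n\ge 0$ and let $V_n$ be the $F$-vector space of dimension $2n+1$ with basis $e_1,\dots,e_n,v_0,f_n,\dots,f_1$ and quadratic form $$q\Big(\sum_i x_ie_i+tv_0+\sum_i y_if_i\Big)=\sum_i x_iy_i+t^2 ,$$ and let $\mathrm{SO}_{2n+1}(F)=\mathrm{SO}(V_n,q)$. Let $\nu:\mathrm{SO}(V_n,q)\to F^\times/(F^\times)^2$ be the spinor norm, i.e. the restriction of the homomorphism on $\mathrm O(V_n,q)$ that sends the reflection $\tau_x$ along an anisotropic vector $x$ to the class of $q(x)$. Let $\eta:F^\times\to\{\pm1\}$ be the unramified quadratic character: $\eta|_{\mathcal O^\times}=1$ and $\eta(\varpi)=-1$; it factors through $F^\times/(F^\times)^2$. Let $J\subset\mathrm{SO}_{2n+1}(F)$ (the epiparamodular subgroup) be the stabilizer of the lattice $L=\bigoplus_i(\mathcal O e_i\oplus\mathfrak p f_i)\oplus\mathfrak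 p v_0$, which has the $\mathcal O$-basis consisting of the $e_i$, $f'_i=\varpi f_i$ and $v'_0=\varpi v_0$. The form $q'=q/\varpi$ is $\mathcal O$-valued on $L$. On $L\otimes k$ it induces a form whose bilinear kernel is the line $k v'_0$, and on the quotient $W=(L\otimes k)/k v'_0$ a nondegenerate form $\bar q'$, namely $\sum_i x_iy_i$ in the basis given by the images of the $e_i,f'_i$. Each $g\in J$ induces $\bar g\in\mathrm O(W,\bar q')$. Let $d:\mathrm O(W,\bar q')\to\{\pm1\}$ be the determinant if $\operatorname{char}k\ne2$ and the Dickson--Dieudonné determinant if $\operatorname{char}k=2$ (that is, $d(h)=1$ if $h$ acts trivially on the centre of the even Clifford algebra of $(W,\bar q')$, and $d(h)=-1$ otherwise). Let $J^+=\{g\in J: d(\bar g)=1\}$ (the paramodular subgroup). Then the restriction of $\eta\circ\nu$ to $J$ is surjective onto $\{\pm1\}$ if $2n+1>1$, and for every $n\ge0$ its kernel is exactly $J^+$. -/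

import Mathlib

open scoped ValuativeRel

namespace Paramodular

section Quadratic

/-- The orthogonal group `O(M, q) = {g ∈ GL(M) | q ∘ g = q}`. -/
def orthogonalGroup {R M : Type*} [CommRing R] [AddCommGroup M] [Module R M]
    (q : QuadraticForm R M) : Subgroup (M ≃ₗ[R] M) where
  carrier := {g | ∀ x, q (g x) = q x}
  mul_mem' {g h} hg hh x := by
    rw [LinearEquiv.mul_apply, hg, hh]
  one_mem' x := rfl
  inv_mem' {g} hg x := by
    rw [← hg (g⁻¹ x), ← LinearEquiv.mul_apply, mul_inv_cancel]
    rfl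

/-- The special orthogonal group `SO(M, q)`: elements of `O(M, q)` of determinant `1`. -/
noncomputable def specialOrthogonalGroup {R M : Type*} [CommRing R] [AddCommGroup M] [Module R M]
    (q : QuadraticForm R M) : Subgroup (M ≃ₗ[R] M) :=
  orthogonalGroup q ⊓ (LinearEquiv.det : (M ≃ₗ[R] M) →* Rˣ).ker

/-- The linear form `y ↦ ⟨x, y⟩ / q(x)`. -/
noncomputable def coroot {K V : Type*} [Field K] [AddCommGroup V] [Module K V]
    (q : QuadraticForm K V) (x : V) : Module.Dual K V :=
  (q x)⁻¹ • QuadraticMap.polarBilin q x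

theorem coroot_self {K V : Type*} [Field K] [AddCommGroup V] [Module K V]
    (q : QuadraticForm K V) (x : {x : V // q x ≠ 0}) : coroot q (x : V) x = 2 := by
  have := x.2
  simp only [coroot, LinearMap.smul_apply, QuadraticMap.polarBilin_apply_apply,
    QuadraticMap.polar_self, smul_eq_mul, nsmul_eq_mul]
  field_simp
  norm_num

/-- The reflection `τ_x : y ↦ y - (⟨x, y⟩ / q(x)) x` along an anisotropic vector `x`. -/
noncomputable def reflection {K V : Type*} [Field K] [AddCommGroup V] [Module K V]
    (q : QuadraticForm K V) (x : {x : V // q x ≠ 0}) : orthogonalGroup q :=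
  ⟨Module.reflection (coroot_self q x), fun y => by
    have hx := x.2
    rw [Module.reflection_apply, sub_eq_add_neg, ← neg_smul, QuadraticMap.map_add (⇑q),
      QuadraticMap.map_smul, QuadraticMap.polar_smul_right, QuadraticMap.polar_comm (⇑q) y]
    simp only [coroot, LinearMap.smul_apply, QuadraticMap.polarBilin_apply_apply, smul_eq_mul]
    field_simp
    ring⟩

theorem reflection_apply {K V : Type*} [Field K] [AddCommGroup V] [Module K V]
    (q : QuadraticForm K V) (x : {x : V // q x ≠ 0}) (y : V) :
    (reflection q x : V ≃ₗ[K] V) y = y - ((q x)⁻¹ * QuadraticMap.polar q x y) • (x : V) := by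
  simp [reflection, Module.reflection_apply, coroot]

theorem reflection_mul_self {K V : Type*} [Field K] [AddCommGroup V] [Module K V]
    (q : QuadraticForm K V) (x : {x : V // q x ≠ 0}) :
    reflection q x * reflection q x = 1 := by
  ext y
  exact Module.involutive_reflection (coroot_self q x) y

/-- The subgroup `(Kˣ)²` of squares. -/
def squares (K : Type*) [Field K] : Subgroup Kˣ := (powMonoidHom 2 : Kˣ →* Kˣ).range

/-- The group `Kˣ / (Kˣ)²`. -/
def SquareClass (K : Type*) [Field K] : Type _ := Kˣ ⧸ squares K

instance SquareClass.instCommGroup (K : Type*) [Field K] : CommGroup (SquareClass K) :=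
  QuotientGroup.Quotient.commGroup (squares K)

/-- The projection `Kˣ → Kˣ / (Kˣ)²`. -/
def SquareClass.mk (K : Type*) [Field K] : Kˣ →* SquareClass K :=
  QuotientGroup.mk' (squares K)

theorem SquareClass.mk_eq_one_iff {K : Type*} [Field K] (u : Kˣ) :
    SquareClass.mk K u = 1 ↔ ∃ c : Kˣ, c ^ 2 = u :=
  QuotientGroup.eq_one_iff (N := squares K) u

theorem SquareClass.mul_self {K : Type*} [Field K] (c : SquareClass K) : c * c = 1 := by
  obtain ⟨u, rfl⟩ := QuotientGroup.mk'_surjective (squares K) c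
  change SquareClass.mk K u * SquareClass.mk K u = 1
  rw [← map_mul, SquareClass.mk_eq_one_iff]
  exact ⟨u, pow_two u⟩

/-- The class of `q(x)` in `Kˣ / (Kˣ)²`. -/
noncomputable def normClass {K V : Type*} [Field K] [AddCommGroup V] [Module K V]
    (q : QuadraticForm K V) (x : {x : V // q x ≠ 0}) : SquareClass K :=
  SquareClass.mk K (Units.mk0 (q x) x.2)

/-- Every isometry is a product of reflections. -/
theorem exists_reflections {K V : Type*} [Field K] [CharZero K] [AddCommGroup V] [Module K V]
    [FiniteDimensional K V] (q : QuadraticForm K V) (hq : q.polarBilin.SeparatingLeft)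
    (g : orthogonalGroup q) :
    ∃ l : List {x : V // q x ≠ 0}, (l.map (reflection q)).prod = g := by
  classical
  have : Invertible (2 : K) := invertibleOfNonzero two_ne_zero
  have hsymm : LinearMap.IsSymm q.polarBilin := ⟨fun x y => by
    simp [QuadraticMap.polar_comm (⇑q) x y]⟩
  obtain ⟨b, hb⟩ := LinearMap.BilinForm.exists_orthogonal_basis hsymm
  have hb' : ∀ i j, i ≠ j → QuadraticMap.polar q (b i) (b j) = 0 := fun i j hij => hb hij
  have hbq : ∀ i, q (b i) ≠ 0 := fun i h => by
    refine hb.not_isOrtho_basis_self_of_separatingLeft hq i ?_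
    change QuadraticMap.polar q (b i) (b i) = 0
    rw [QuadraticMap.polar_self, h, smul_zero]
  have key : ∀ m : ℕ, m ≤ Module.finrank K V → ∃ l : List {x : V // q x ≠ 0},
      ∀ i : Fin (Module.finrank K V), (i : ℕ) < m →
        (((l.map (reflection q)).prod * g : orthogonalGroup q) : V ≃ₗ[K] V) (b i) = b i := by
    intro m
    induction m with
    | zero => exact fun _ => ⟨[], fun i hi => absurd hi (Nat.not_lt_zero _)⟩
    | succ m ih =>
      intro hm
      obtain ⟨l, hl⟩ := ih (by omega)
      set h : orthogonalGroup q := (l.map (reflection q)).prod * g with hh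
      let i₀ : Fin (Module.finrank K V) := ⟨m, by omega⟩
      set x := b i₀ with hx
      set y := (h : V ≃ₗ[K] V) x with hy
      have hqy : q y = q x := h.2 x
      have hort : ∀ j : Fin (Module.finrank K V), (j : ℕ) < m →
          QuadraticMap.polar q y (b j) = 0 := fun j hj => by
        have h1 : QuadraticMap.polar q y (b j) = QuadraticMap.polar q x (b j) := by
          conv_lhs => rw [← hl j hj]
          simp only [hy, QuadraticMap.polar, ← map_add]
          rw [h.2, h.2, h.2]
        rw [h1]
        exact hb' _ _ (fun e => by simp [← e, i₀] at hj)
      have hort' : ∀ j : Fin (Module.finrank K V), (j : ℕ) < m →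
          QuadraticMap.polar q x (b j) = 0 := fun j hj =>
        hb' _ _ (fun e => by simp [← e, i₀] at hj)
      have hsum : q (y - x) + q (y + x) = 4 * q x := by
        have e1 := QuadraticMap.map_add (⇑q) y x
        have e2 := QuadraticMap.map_add (⇑q) y (-x)
        rw [QuadraticMap.polar_neg_right, QuadraticMap.map_neg] at e2
        rw [sub_eq_add_neg, e1, e2, hqy]; ring
      by_cases hd : q (y - x) = 0
      · have hs : q (y + x) ≠ 0 := fun hs => by
          rw [hd, hs] at hsum
          exact hbq i₀ (by simpa using hsum)
        have hp : QuadraticMap.polar q (y + x) y = q (y + x) := by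
          have e1 := QuadraticMap.map_add (⇑q) y x
          rw [QuadraticMap.polar_add_left, QuadraticMap.polar_self, e1, hqy,
            QuadraticMap.polar_comm (⇑q) x y]; ring
        refine ⟨⟨x, hbq i₀⟩ :: ⟨y + x, hs⟩ :: l, fun j hj => ?_⟩
        simp only [List.map_cons, List.prod_cons, mul_assoc]
        rw [← hh]
        simp only [Subgroup.coe_mul, LinearEquiv.mul_apply]
        rcases Nat.lt_succ_iff_lt_or_eq.mp hj with hj | hj
        · rw [hl j hj, reflection_apply, reflection_apply]
          simp [QuadraticMap.polar_add_left, hort j hj, hort' j hj]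
        · obtain rfl : j = i₀ := Fin.ext hj
          rw [← hx, ← hy, reflection_apply, reflection_apply]
          simp only [hp, inv_mul_cancel₀ hs, one_smul]
          have : y - (y + x) = -x := by abel
          rw [this, QuadraticMap.polar_neg_right, QuadraticMap.polar_self]
          have h0 := hbq i₀
          rw [← hx] at h0
          have : (q x)⁻¹ * -(2 • q x) = -2 := by
            rw [nsmul_eq_mul]; field_simp; norm_num
          rw [this, neg_smul, two_smul]; abel
      · have hp : QuadraticMap.polar q (y - x) y = q (y - x) := by
          have e2 := QuadraticMap.map_add (⇑q) y (-x)
          rw [QuadraticMap.polar_neg_right, QuadraticMap.map_neg] at e2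
          rw [sub_eq_add_neg, e2, QuadraticMap.polar_add_left, QuadraticMap.polar_self, hqy,
            QuadraticMap.polar_neg_left, QuadraticMap.polar_comm (⇑q) x y]; ring
        refine ⟨⟨y - x, hd⟩ :: l, fun j hj => ?_⟩
        simp only [List.map_cons, List.prod_cons, mul_assoc]
        rw [← hh]
        simp only [Subgroup.coe_mul, LinearEquiv.mul_apply]
        rcases Nat.lt_succ_iff_lt_or_eq.mp hj with hj | hj
        · rw [hl j hj, reflection_apply]
          simp [sub_eq_add_neg, QuadraticMap.polar_add_left, QuadraticMap.polar_neg_left,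
            hort j hj, hort' j hj]
        · obtain rfl : j = i₀ := Fin.ext hj
          rw [← hx, ← hy, reflection_apply]
          simp only [hp, inv_mul_cancel₀ hd, one_smul]
          abel
  obtain ⟨l, hl⟩ := key _ le_rfl
  have h1 : (l.map (reflection q)).prod * g = 1 := by
    apply Subtype.ext
    apply LinearEquiv.toLinearMap_injective
    exact b.ext fun i => hl i i.2
  have h2 : ((l.reverse.map (reflection q)).prod) * (l.map (reflection q)).prod = 1 := by
    clear h1 hl
    induction l with
    | nil => simp
    | cons a l ih =>
      simp only [List.reverse_cons, List.map_append, List.map_cons, List.map_nil,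
        List.prod_append, List.prod_cons, List.prod_nil, mul_one]
      rw [mul_assoc, ← mul_assoc (reflection q a), reflection_mul_self, one_mul, ih]
  exact ⟨l.reverse, by rw [← mul_one (List.prod _), ← h1, ← mul_assoc, h2, one_mul]⟩

/-- An element of a Clifford algebra killed by every contraction is a scalar. -/
theorem exists_eq_algebraMap_of_contractLeft {K V : Type*} [Field K] [CharZero K]
    [AddCommGroup V] [Module K V] [FiniteDimensional K V] (q : QuadraticForm K V)
    (z : CliffordAlgebra q)
    (hz : ∀ d : Module.Dual K V, CliffordAlgebra.contractLeft d z = 0) :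
    ∃ c : K, z = algebraMap K (CliffordAlgebra q) c := by
  classical
  have : Invertible (2 : K) := invertibleOfNonzero two_ne_zero
  let b := Module.finBasis K V
  let N : ExteriorAlgebra K V →ₗ[K] ExteriorAlgebra K V :=
    ∑ i, (LinearMap.mulLeft K (ExteriorAlgebra.ι K (b i))) ∘ₗ
      (CliffordAlgebra.contractLeft (Q := (0 : QuadraticForm K V)) (b.coord i))
  have hNapp : ∀ x, N x = ∑ i, ExteriorAlgebra.ι K (b i) *
      CliffordAlgebra.contractLeft (Q := (0 : QuadraticForm K V)) (b.coord i) x := fun x => by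
    simp [N]
  have hN : ∀ (a : V) (x : ExteriorAlgebra K V),
      N (ExteriorAlgebra.ι K a * x) = ExteriorAlgebra.ι K a * x + ExteriorAlgebra.ι K a * N x := by
    intro a x
    have h1 : ∀ i, ExteriorAlgebra.ι K (b i) *
        CliffordAlgebra.contractLeft (Q := (0 : QuadraticForm K V)) (b.coord i)
          (ExteriorAlgebra.ι K a * x) =
        ExteriorAlgebra.ι K (b.coord i a • b i) * x + ExteriorAlgebra.ι K a *
          (ExteriorAlgebra.ι K (b i) *
            CliffordAlgebra.contractLeft (Q := (0 : QuadraticForm K V)) (b.coord i) x) := by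
      intro i
      have h2 := CliffordAlgebra.contractLeft_ι_mul (Q := (0 : QuadraticForm K V))
        (d := b.coord i) a x
      have h3 := ExteriorAlgebra.ι_add_mul_swap (R := K) a (b i)
      have h4 : ExteriorAlgebra.ι K (b i) * ExteriorAlgebra.ι K a =
        - (ExteriorAlgebra.ι K a * ExteriorAlgebra.ι K (b i)) := by
        rw [eq_neg_iff_add_eq_zero, add_comm]; exact h3
      erw [h2]
      rw [mul_sub]
      erw [← mul_assoc (ExteriorAlgebra.ι K (b i)) (ExteriorAlgebra.ι K a), h4]
      rw [map_smul, mul_smul_comm, smul_mul_assoc, neg_mul, sub_neg_eq_add, mul_assoc]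
    rw [hNapp, Finset.sum_congr rfl (fun i _ => h1 i), Finset.sum_add_distrib, ← Finset.mul_sum,
      ← hNapp, ← Finset.sum_mul, ← map_sum]
    congr 3
    exact b.sum_repr a
  have hN1 : ∀ c : K, N (algebraMap K _ c) = 0 := fun c => by
    rw [hNapp]
    refine Finset.sum_eq_zero fun i _ => ?_
    erw [CliffordAlgebra.contractLeft_algebraMap]
    exact mul_zero _
  have hdeg : ∀ (k : ℕ) (x : ExteriorAlgebra K V), x ∈ ⋀[K]^k V → N x = (k : K) • x := by
    intro k
    induction k with
    | zero =>
      intro x hx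
      change x ∈ (LinearMap.range (ExteriorAlgebra.ι K (M := V))) ^ 0 at hx
      rw [pow_zero, Submodule.mem_one] at hx
      obtain ⟨c, rfl⟩ := hx
      rw [hN1]; simp
    | succ k ih =>
      intro x hx
      change x ∈ (LinearMap.range (ExteriorAlgebra.ι K (M := V))) ^ (k + 1) at hx
      rw [pow_succ'] at hx
      induction hx using Submodule.mul_induction_on' with
      | mem_mul_mem m hm n hn =>
        obtain ⟨a, rfl⟩ := hm
        rw [hN, ih n hn, mul_smul_comm, Nat.cast_succ, add_smul, one_smul, add_comm]
      | add x _ y _ hx hy => rw [map_add, hx, hy, smul_add]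
  set e := CliffordAlgebra.equivExterior q with he
  have hez : ∀ d : Module.Dual K V,
      CliffordAlgebra.contractLeft (Q := (0 : QuadraticForm K V)) d (e z) = 0 := by
    intro d
    have h := CliffordAlgebra.changeForm_contractLeft
      (CliffordAlgebra.changeForm.associated_neg_proof (Q := q)) d z
    rw [hz, map_zero] at h
    exact h.symm
  have hNz : N (e z) = 0 := by
    rw [hNapp]
    exact Finset.sum_eq_zero fun i _ => by rw [hez, mul_zero]
  have hdec := DirectSum.sum_support_decompose (fun i : ℕ => ⋀[K]^i V) (e z)
  have hcomp : ∀ k : ℕ, k ≠ 0 → (DirectSum.decompose (fun i : ℕ => ⋀[K]^i V) (e z) k :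
      ExteriorAlgebra K V) = 0 := by
    intro k hk
    have h1 : N (e z) = ∑ i ∈ (DirectSum.decompose (fun i : ℕ => ⋀[K]^i V) (e z)).support,
        (i : K) • (DirectSum.decompose (fun i : ℕ => ⋀[K]^i V) (e z) i : ExteriorAlgebra K V) := by
      conv_lhs => rw [← hdec]
      rw [map_sum]
      exact Finset.sum_congr rfl fun i _ => hdeg i _ (SetLike.coe_mem _)
    have h2 := congrArg (fun w => (DirectSum.decompose (fun i : ℕ => ⋀[K]^i V) w k :
      ExteriorAlgebra K V)) (h1.symm.trans hNz)
    simp only [DirectSum.decompose_sum, DirectSum.decompose_smul, DirectSum.decompose_zero,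
      DirectSum.decompose_coe] at h2
    by_contra hne
    have hks : k ∈ (DirectSum.decompose (fun i : ℕ => ⋀[K]^i V) (e z)).support := by
      rw [DFinsupp.mem_support_iff]
      intro h0
      exact hne (by rw [h0]; rfl)
    rw [DFinsupp.finsetSum_apply, Finset.sum_eq_single_of_mem k hks] at h2
    · rw [DirectSum.smul_apply, DirectSum.of_eq_same, Submodule.coe_smul] at h2
      rcases smul_eq_zero.mp h2 with h2 | h2
      · exact hk (Nat.cast_eq_zero.mp h2)
      · exact hne h2
    · intro j _ hj
      rw [DirectSum.smul_apply, DirectSum.of_eq_of_ne _ _ _ (Ne.symm hj), smul_zero]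
  have h0 : e z ∈ ⋀[K]^0 V := by
    rw [← hdec]
    refine Submodule.sum_mem _ fun i _ => ?_
    rcases Nat.eq_zero_or_pos i with rfl | hi
    · exact SetLike.coe_mem _
    · rw [hcomp i hi.ne']; exact Submodule.zero_mem _
  change e z ∈ (LinearMap.range (ExteriorAlgebra.ι K (M := V))) ^ 0 at h0
  rw [pow_zero, Submodule.mem_one] at h0
  obtain ⟨c, hc⟩ := h0
  refine ⟨c, e.injective ?_⟩
  rw [← hc]
  exact (CliffordAlgebra.changeForm_algebraMap
    (CliffordAlgebra.changeForm.associated_neg_proof (Q := q)) c).symm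

/-- If a product of reflections is trivial, the product of the norms of the vectors is a square. -/
theorem prod_normClass_eq_one {K V : Type*} [Field K] [CharZero K] [AddCommGroup V] [Module K V]
    [FiniteDimensional K V] (q : QuadraticForm K V) (hq : q.polarBilin.SeparatingLeft)
    (l : List {x : V // q x ≠ 0}) (hl : (l.map (reflection q)).prod = 1) :
    (l.map (normClass q)).prod = 1 := by
  classical
  let z : List {x : V // q x ≠ 0} → CliffordAlgebra q := fun l =>
    (l.map fun x : {x : V // q x ≠ 0} => CliffordAlgebra.ι q (x : V)).prod
  have hconj : ∀ (l : List {x : V // q x ≠ 0}) (v : V),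
      CliffordAlgebra.involute (z l) * CliffordAlgebra.ι q v =
        CliffordAlgebra.ι q (((l.map (reflection q)).prod : V ≃ₗ[K] V) v) * z l := by
    intro l
    induction l with
    | nil => intro v; simp [z]
    | cons x l ih =>
      intro v
      have hz : z (x :: l) = CliffordAlgebra.ι q (x : V) * z l := by simp [z]
      rw [hz, map_mul, CliffordAlgebra.involute_ι, mul_assoc, ih, List.map_cons, List.prod_cons,
        Subgroup.coe_mul, LinearEquiv.mul_apply, reflection_apply, ← mul_assoc, ← mul_assoc]
      congr 1
      set w := ((l.map (reflection q)).prod : V ≃ₗ[K] V) v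
      rw [map_sub, map_smul, sub_mul, smul_mul_assoc, CliffordAlgebra.ι_sq_scalar, neg_mul,
        CliffordAlgebra.ι_mul_ι_comm, Algebra.smul_def, ← map_mul (algebraMap K _)]
      have hx := x.2
      have : (q x)⁻¹ * QuadraticMap.polar q x w * q x = QuadraticMap.polar q x w := by
        field_simp
      rw [this]
      abel
  have hcomm : ∀ (v : V) (x : CliffordAlgebra q),
      CliffordAlgebra.contractLeft (QuadraticMap.polarBilin q v) x =
        CliffordAlgebra.ι q v * x - CliffordAlgebra.involute x * CliffordAlgebra.ι q v := by
    intro v x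
    induction x using CliffordAlgebra.left_induction with
    | algebraMap r =>
      rw [CliffordAlgebra.contractLeft_algebraMap, AlgHom.commutes, Algebra.commutes, sub_self]
    | add x y hx hy => rw [map_add, map_add, hx, hy, mul_add, add_mul]; abel
    | ι_mul x a hx =>
      rw [CliffordAlgebra.contractLeft_ι_mul, hx, map_mul, CliffordAlgebra.involute_ι,
        QuadraticMap.polarBilin_apply_apply, Algebra.smul_def, mul_sub,
        ← mul_assoc (CliffordAlgebra.ι q v), CliffordAlgebra.ι_mul_ι_comm v a, sub_mul]
      simp only [neg_mul, mul_assoc]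
      abel
  have hsurj : Function.Surjective q.polarBilin :=
    (LinearMap.injective_iff_surjective_of_finrank_eq_finrank
      (Subspace.dual_finrank_eq).symm).mp
      (LinearMap.ker_eq_bot.mp (LinearMap.separatingLeft_iff_ker_eq_bot.mp hq))
  have hcontr : ∀ d : Module.Dual K V, CliffordAlgebra.contractLeft d (z l) = 0 := by
    intro d
    obtain ⟨v, rfl⟩ := hsurj d
    rw [hcomm, hconj l v, hl]
    exact sub_self _
  obtain ⟨c, hc⟩ := exists_eq_algebraMap_of_contractLeft q (z l) hcontr
  have hrev : ∀ l : List {x : V // q x ≠ 0},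
      CliffordAlgebra.reverse (z l) * z l =
        algebraMap K _ ((l.map fun x : {x : V // q x ≠ 0} => q (x : V)).prod) := by
    intro l
    induction l with
    | nil => simp [z]
    | cons x l ih =>
      have hz : z (x :: l) = CliffordAlgebra.ι q (x : V) * z l := by simp [z]
      rw [hz, CliffordAlgebra.reverse.map_mul, CliffordAlgebra.reverse_ι, mul_assoc,
        ← mul_assoc (CliffordAlgebra.ι q (x : V)), CliffordAlgebra.ι_sq_scalar,
        ← mul_assoc, ← Algebra.commutes, mul_assoc, ih, ← map_mul, List.map_cons, List.prod_cons]
  have hcc : (l.map fun x : {x : V // q x ≠ 0} => q (x : V)).prod = c * c := by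
    have h := hrev l
    rw [hc, CliffordAlgebra.reverse.commutes, ← map_mul] at h
    exact ((algebraMap K (CliffordAlgebra q)).injective h).symm
  have hunit : ((l.map fun x : {x : V // q x ≠ 0} => Units.mk0 (q (x : V)) x.2).prod : Kˣ) =
      ((l.map fun x : {x : V // q x ≠ 0} => q (x : V)).prod : K) := by
    rw [← Units.coeHom_apply, map_list_prod, List.map_map]
    rfl
  have hmk : (l.map (normClass q)).prod = SquareClass.mk K
      ((l.map fun x : {x : V // q x ≠ 0} => Units.mk0 (q (x : V)) x.2).prod) := by
    rw [map_list_prod, List.map_map]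
    rfl
  rw [hmk, SquareClass.mk_eq_one_iff]
  have hc0 : c ≠ 0 := by
    rintro rfl
    rw [hcc, mul_zero] at hunit
    exact Units.ne_zero _ hunit
  refine ⟨Units.mk0 c hc0, Units.ext ?_⟩
  rw [hunit, hcc]
  simp [pow_two]

/-- A list of anisotropic vectors whose reflections have product `g`. -/
noncomputable def reflectionList {K V : Type*} [Field K] [CharZero K] [AddCommGroup V]
    [Module K V] [FiniteDimensional K V] (q : QuadraticForm K V)
    (hq : q.polarBilin.SeparatingLeft) (g : orthogonalGroup q) : List {x : V // q x ≠ 0} :=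
  (exists_reflections q hq g).choose

theorem prod_reflectionList {K V : Type*} [Field K] [CharZero K] [AddCommGroup V]
    [Module K V] [FiniteDimensional K V] (q : QuadraticForm K V)
    (hq : q.polarBilin.SeparatingLeft) (g : orthogonalGroup q) :
    ((reflectionList q hq g).map (reflection q)).prod = g :=
  (exists_reflections q hq g).choose_spec

/-- The product of the norms depends only on the product of the reflections. -/
theorem prod_normClass_congr {K V : Type*} [Field K] [CharZero K] [AddCommGroup V] [Module K V]
    [FiniteDimensional K V] (q : QuadraticForm K V) (hq : q.polarBilin.SeparatingLeft)
    (l₁ l₂ : List {x : V // q x ≠ 0})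
    (h : (l₁.map (reflection q)).prod = (l₂.map (reflection q)).prod) :
    (l₁.map (normClass q)).prod = (l₂.map (normClass q)).prod := by
  have h1 := prod_normClass_eq_one q hq (l₁ ++ l₂.reverse) (by
    have hinv : (fun g : orthogonalGroup q => g⁻¹) ∘ reflection q = reflection q :=
      funext fun x => (eq_inv_of_mul_eq_one_left (reflection_mul_self q x)).symm
    rw [List.map_append, List.prod_append, h, mul_eq_one_iff_eq_inv, List.prod_inv_reverse,
      List.map_map, hinv, List.map_reverse, List.reverse_reverse])
  rw [List.map_append, List.prod_append, ((l₂.reverse_perm).map (normClass q)).prod_eq] at h1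
  calc _ = (l₁.map (normClass q)).prod * ((l₂.map (normClass q)).prod *
        (l₂.map (normClass q)).prod) := by rw [SquareClass.mul_self, mul_one]
    _ = _ := by rw [← mul_assoc, h1, one_mul]

/-- The spinor norm on `O(V, q)`: the homomorphism to `Kˣ / (Kˣ)²` sending each reflection `τ_x`
to the class of `q(x)`. -/
noncomputable def spinorNormO {K V : Type*} [Field K] [CharZero K] [AddCommGroup V]
    [Module K V] [FiniteDimensional K V] (q : QuadraticForm K V)
    (hq : q.polarBilin.SeparatingLeft) : orthogonalGroup q →* SquareClass K where
  toFun g := ((reflectionList q hq g).map (normClass q)).prod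
  map_one' := prod_normClass_eq_one q hq _ (prod_reflectionList q hq 1)
  map_mul' g h := by
    rw [← List.prod_append, ← List.map_append]
    apply prod_normClass_congr q hq
    rw [List.map_append, List.prod_append]
    simp only [prod_reflectionList]

theorem spinorNormO_reflection {K V : Type*} [Field K] [CharZero K] [AddCommGroup V]
    [Module K V] [FiniteDimensional K V] (q : QuadraticForm K V)
    (hq : q.polarBilin.SeparatingLeft) (x : {x : V // q x ≠ 0}) :
    spinorNormO q hq (reflection q x) = normClass q x := by
  have h := prod_normClass_congr q hq (reflectionList q hq (reflection q x)) [x] (by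
    rw [prod_reflectionList]; simp)
  rw [List.map_singleton, List.prod_singleton] at h
  exact h

/-- The spinor norm `ν : SO(V, q) → Kˣ / (Kˣ)²`. -/
noncomputable def spinorNorm {K V : Type*} [Field K] [CharZero K] [AddCommGroup V]
    [Module K V] [FiniteDimensional K V] (q : QuadraticForm K V)
    (hq : q.polarBilin.SeparatingLeft) : specialOrthogonalGroup q →* SquareClass K :=
  (spinorNormO q hq).comp (Subgroup.inclusion inf_le_left)

end Quadratic

section Determinant

/-- `g` acts trivially on the centre of the even Clifford algebra of `r`. -/
def FixesEvenCenter {k W : Type*} [Field k] [AddCommGroup W] [Module k W]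
    (r : QuadraticForm k W) (g : orthogonalGroup r) : Prop :=
  ∀ z ∈ CliffordAlgebra.even r, (∀ w ∈ CliffordAlgebra.even r, z * w = w * z) →
    CliffordAlgebra.map (⟨((g : W ≃ₗ[k] W) : W →ₗ[k] W), g.2⟩ : r →qᵢ r) z = z

open Classical in
/-- The Dickson--Dieudonné determinant, with values in `{±1}`, of an isometry of a nondegenerate
quadratic space of even dimension: it records the action on the centre of the even Clifford algebra
(an étale quadratic algebra). -/
noncomputable def dicksonDet {k W : Type*} [Field k] [AddCommGroup W] [Module k W]
    (r : QuadraticForm k W) (g : orthogonalGroup r) : ℤˣ :=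
  if FixesEvenCenter r g then 1 else -1

open Classical in
/-- The map `d : O(W, r) → {±1}` (`W` nondegenerate of even dimension): the determinant if
`char k ≠ 2`, the Dickson--Dieudonné determinant if `char k = 2`. -/
noncomputable def signDet {k W : Type*} [Field k] [AddCommGroup W] [Module k W]
    (r : QuadraticForm k W) (g : orthogonalGroup r) : ℤˣ :=
  if ringChar k = 2 then dicksonDet r g
  else if LinearEquiv.det (g : W ≃ₗ[k] W) = 1 then 1 else -1

theorem signDet_eq_one_iff {k W : Type*} [Field k] [AddCommGroup W] [Module k W]
    (r : QuadraticForm k W) (g : orthogonalGroup r) :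
    signDet r g = 1 ↔ (if ringChar k = 2 then FixesEvenCenter r g
      else LinearEquiv.det (g : W ≃ₗ[k] W) = 1) := by
  have h : (-1 : ℤˣ) ≠ 1 := by decide
  unfold signDet dicksonDet
  split_ifs <;> simp_all

theorem FixesEvenCenter.mul {k W : Type*} [Field k] [AddCommGroup W] [Module k W]
    {r : QuadraticForm k W} {g h : orthogonalGroup r} (hg : FixesEvenCenter r g)
    (hh : FixesEvenCenter r h) : FixesEvenCenter r (g * h) := by
  intro z hz hc
  have e : (⟨(((g * h : orthogonalGroup r) : W ≃ₗ[k] W) : W →ₗ[k] W), (g * h).2⟩ : r →qᵢ r) =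
      (⟨((g : W ≃ₗ[k] W) : W →ₗ[k] W), g.2⟩ : r →qᵢ r).comp
        ⟨((h : W ≃ₗ[k] W) : W →ₗ[k] W), h.2⟩ := rfl
  rw [e, ← CliffordAlgebra.map_comp_map, AlgHom.comp_apply, hh z hz hc, hg z hz hc]

/-- The subgroup `{g ∈ O(W, r) | d(g) = 1}`. -/
def signDetKer {k W : Type*} [Field k] [AddCommGroup W] [Module k W]
    (r : QuadraticForm k W) : Subgroup (orthogonalGroup r) where
  carrier := {g | signDet r g = 1}
  mul_mem' {g h} hg hh := by
    simp only [Set.mem_ofPred_eq, signDet_eq_one_iff] at *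
    split_ifs at * with h2
    · exact hg.mul hh
    · rw [Subgroup.coe_mul, map_mul, hg, hh, one_mul]
  one_mem' := by
    simp only [Set.mem_ofPred_eq, signDet_eq_one_iff]
    split_ifs with h2
    · intro z _ _
      have e : (⟨(((1 : orthogonalGroup r) : W ≃ₗ[k] W) : W →ₗ[k] W),
        (1 : orthogonalGroup r).2⟩ : r →qᵢ r) = QuadraticMap.Isometry.id r := rfl
      rw [e, CliffordAlgebra.map_id, AlgHom.id_apply]
    · rw [Subgroup.coe_one, map_one]
  inv_mem' {g} hg := by
    simp only [Set.mem_ofPred_eq, signDet_eq_one_iff] at *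
    split_ifs at * with h2
    · intro z hz hc
      have h := hg z hz hc
      conv_lhs => rw [← h]
      rw [← AlgHom.comp_apply, CliffordAlgebra.map_comp_map]
      have e : (⟨(((g⁻¹ : orthogonalGroup r) : W ≃ₗ[k] W) : W →ₗ[k] W), (g⁻¹).2⟩ : r →qᵢ r).comp
          (⟨((g : W ≃ₗ[k] W) : W →ₗ[k] W), g.2⟩ : r →qᵢ r) = QuadraticMap.Isometry.id r := by
        ext x
        exact LinearEquiv.symm_apply_apply (g : W ≃ₗ[k] W) x
      rw [e, CliffordAlgebra.map_id, AlgHom.id_apply]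
    · rw [Subgroup.coe_inv, map_inv, hg, inv_one]

end Determinant

section SplitForm

/-- Index set of the basis: `inl (inl i)` for `e_i`, `inl (inr i)` for `f_i`, `inr ()` for `v₀`. -/
abbrev Idx (n : ℕ) : Type := (Fin n ⊕ Fin n) ⊕ Unit

/-- The hyperbolic form `∑ x_i y_i` of dimension `2n`. -/
def hyperbolicForm (R : Type*) [CommRing R] (n : ℕ) : QuadraticForm R (Fin n ⊕ Fin n → R) :=
  ∑ i, QuadraticMap.linMulLin (LinearMap.proj (Sum.inl i)) (LinearMap.proj (Sum.inr i))

theorem hyperbolicForm_apply {R : Type*} [CommRing R] {n : ℕ} (x : Fin n ⊕ Fin n → R) :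
    hyperbolicForm R n x = ∑ i, x (Sum.inl i) * x (Sum.inr i) := by
  simp [hyperbolicForm]

/-- The form `q` on `V_n`, of dimension `2n + 1`, with `⟨e_i, f_j⟩ = δ_ij`, `⟨v₀, v₀⟩ = 2` and all
other products of basis vectors zero, i.e. `q(∑ x_i e_i + ∑ y_i f_i + t v₀) = ∑ x_i y_i + t²`. -/
def splitForm (R : Type*) [CommRing R] (n : ℕ) : QuadraticForm R (Idx n → R) :=
  (hyperbolicForm R n).comp (LinearMap.funLeft R R Sum.inl) +
    QuadraticMap.linMulLin (LinearMap.proj (Sum.inr ())) (LinearMap.proj (Sum.inr ()))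

theorem splitForm_apply {R : Type*} [CommRing R] {n : ℕ} (x : Idx n → R) :
    splitForm R n x = ∑ i, x (Sum.inl (Sum.inl i)) * x (Sum.inl (Sum.inr i)) +
      x (Sum.inr ()) * x (Sum.inr ()) := by
  simp [splitForm, hyperbolicForm_apply, LinearMap.funLeft_apply]

theorem polar_hyperbolicForm {R : Type*} [CommRing R] {n : ℕ} (x y : Fin n ⊕ Fin n → R) :
    QuadraticMap.polar (hyperbolicForm R n) x y =
      ∑ i, (x (Sum.inl i) * y (Sum.inr i) + x (Sum.inr i) * y (Sum.inl i)) := by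
  simp only [QuadraticMap.polar, hyperbolicForm_apply, Pi.add_apply, ← Finset.sum_sub_distrib]
  exact Finset.sum_congr rfl fun i _ => by ring

theorem eq_zero_of_polar_hyperbolicForm {R : Type*} [CommRing R] {n : ℕ} (x : Fin n ⊕ Fin n → R)
    (h : ∀ y, QuadraticMap.polar (hyperbolicForm R n) x y = 0) : x = 0 := by
  classical
  funext j
  rcases j with i | i
  · have := h (Pi.single (Sum.inr i) 1)
    simpa [polar_hyperbolicForm, Pi.single_apply] using this
  · have := h (Pi.single (Sum.inl i) 1)
    simpa [polar_hyperbolicForm, Pi.single_apply] using this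

theorem polar_splitForm {R : Type*} [CommRing R] {n : ℕ} (x y : Idx n → R) :
    QuadraticMap.polar (splitForm R n) x y =
      QuadraticMap.polar (hyperbolicForm R n) (x ∘ Sum.inl) (y ∘ Sum.inl) +
        2 * x (Sum.inr ()) * y (Sum.inr ()) := by
  simp only [QuadraticMap.polar, splitForm_apply, hyperbolicForm_apply, Pi.add_apply,
    Function.comp_apply]
  ring

theorem splitForm_separatingLeft (K : Type*) [Field K] [CharZero K] (n : ℕ) :
    (splitForm K n).polarBilin.SeparatingLeft := by
  classical
  intro x hx
  have h (y : Idx n → K) : QuadraticMap.polar (splitForm K n) x y = 0 := hx y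
  have h1 : x ∘ Sum.inl = 0 := eq_zero_of_polar_hyperbolicForm _ fun y => by
    have := h (Sum.elim y 0)
    simpa [polar_splitForm] using this
  have h2 : x (Sum.inr ()) = 0 := by
    have := h (Pi.single (Sum.inr ()) 1)
    simpa [polar_splitForm, h1, polar_hyperbolicForm] using this
  funext j
  rcases j with j | ⟨⟩
  · exact congrFun h1 j
  · exact h2

end SplitForm

section LocalField

variable (F : Type*) [Field F] [ValuativeRel F] [TopologicalSpace F] [IsNonarchimedeanLocalField F]

/-- The normalized additive valuation `Fˣ → ℤ` up to sign, written multiplicatively. -/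
noncomputable def ordHom : Fˣ →* Multiplicative ℤ :=
  (WithZero.unitsWithZeroEquiv (α := Multiplicative ℤ)).toMonoidHom.comp
    ((Units.map (IsNonarchimedeanLocalField.valueGroupWithZeroIsoInt F :
        ValuativeRel.ValueGroupWithZero F →* WithZero (Multiplicative ℤ))).comp
      (Units.map (ValuativeRel.valuation F : F →* ValuativeRel.ValueGroupWithZero F)))

/-- The unramified quadratic character `η : Fˣ → {±1}`, `η(x) = (-1)^{ord(x)}`. -/
noncomputable def eta : Fˣ →* ℤˣ := (zpowersHom ℤˣ (-1)).comp (ordHom F)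

/-- `η` as a character of `Fˣ / (Fˣ)²`. -/
noncomputable def etaBar : SquareClass F →* ℤˣ :=
  QuotientGroup.lift (squares F) (eta F) (by
    rintro _ ⟨c, rfl⟩
    rw [MonoidHom.mem_ker, powMonoidHom_apply, map_pow, Int.units_sq])

/-- `η` is trivial on the units of `𝒪`. -/
theorem eta_eq_one_of_isUnit (u : Fˣ) (a : 𝒪[F]) (ha : IsUnit a) (hu : (a : F) = u) :
    eta F u = 1 := by
  have h1 : ValuativeRel.valuation F (u : F) = 1 := by
    rw [← hu]
    exact (Valuation.integer.integers (ValuativeRel.valuation F)).valuation_unit ha.unit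
  have h2 : Units.map (ValuativeRel.valuation F : F →* ValuativeRel.ValueGroupWithZero F) u = 1 :=
    Units.ext h1
  rw [eta, ordHom, MonoidHom.comp_apply, MonoidHom.comp_apply, MonoidHom.comp_apply, h2, map_one,
    map_one, map_one]

/-- `η` takes the value `-1` on uniformizers. -/
theorem eta_uniformizer (u : Fˣ) (a : 𝒪[F]) (ha : Irreducible a) (hu : (a : F) = u) :
    eta F u = -1 := by
  by_contra hne
  have hu1 : eta F u = 1 := (Int.units_eq_one_or _).resolve_right hne
  have hint : ∀ (x : Fˣ) (b : 𝒪[F]), (b : F) = x → eta F x = 1 := by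
    intro x b hb
    have hb0 : b ≠ 0 := by
      rintro rfl
      exact x.ne_zero hb.symm
    obtain ⟨k, w, hw⟩ := IsDiscreteValuationRing.eq_unit_mul_pow_irreducible hb0 ha
    have hx : x = Units.map (𝒪[F].subtype : 𝒪[F] →* F) w * u ^ k := by
      apply Units.ext
      rw [← hb, hw, Units.val_mul, Units.val_pow_eq_pow_val, ← hu]
      rfl
    rw [hx, map_mul, map_pow, hu1, one_pow, mul_one]
    exact eta_eq_one_of_isUnit F _ (w : 𝒪[F]) w.isUnit rfl
  have hall : ∀ x : Fˣ, eta F x = 1 := by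
    intro x
    rcases le_total (ValuativeRel.valuation F (x : F)) 1 with h | h
    · exact hint x ⟨x, h⟩ rfl
    · rw [← inv_inv x, map_inv, hint x⁻¹ ⟨((x⁻¹ : Fˣ) : F), ?_⟩ rfl, inv_one]
      change ValuativeRel.valuation F ((x⁻¹ : Fˣ) : F) ≤ 1
      rw [Units.val_inv_eq_inv_val, map_inv₀]
      exact inv_le_one_of_one_le₀ h
  obtain ⟨y, hy⟩ := (WithZero.unitsWithZeroEquiv (α := Multiplicative ℤ)).surjective
    (Multiplicative.ofAdd 1)
  obtain ⟨z, hz⟩ := (IsNonarchimedeanLocalField.valueGroupWithZeroIsoInt F).surjective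
    (y : WithZero (Multiplicative ℤ))
  obtain ⟨x, hx⟩ := ValuativeRel.valuation_surjective z
  have hx0 : x ≠ 0 := by
    rintro rfl
    rw [map_zero] at hx
    rw [← hx, map_zero] at hz
    exact y.ne_zero hz.symm
  have hord : ordHom F (Units.mk0 x hx0) = Multiplicative.ofAdd 1 := by
    rw [← hy]
    change WithZero.unitsWithZeroEquiv _ = _
    congr 1
    apply Units.ext
    rw [← hz, ← hx]
    rfl
  have h := hall (Units.mk0 x hx0)
  rw [eta, MonoidHom.comp_apply, hord] at h
  exact absurd h (by decide)

/-- The ideals `𝒪` (for `e_i`) and `𝔭` (for `f_i` and `v₀`) of coordinates of the lattice `L`. -/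
noncomputable def latticeIdeal (n : ℕ) : Idx n → Ideal 𝒪[F] :=
  Sum.elim (Sum.elim (fun _ => ⊤) (fun _ => 𝓂[F])) (fun _ => 𝓂[F])

/-- The lattice `L = ⨁ (𝒪 e_i ⊕ 𝔭 f_i) ⊕ 𝔭 v₀` of `V_n`. -/
noncomputable def lattice (n : ℕ) : Submodule 𝒪[F] (Idx n → F) :=
  Submodule.pi Set.univ fun i => Submodule.map (Algebra.linearMap 𝒪[F] F) (latticeIdeal F n i)

/-- The epiparamodular subgroup `J` of `SO(V_n, q)`: the stabilizer of the lattice `L`. -/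
noncomputable def epiparamodular (n : ℕ) :
    Subgroup (specialOrthogonalGroup (splitForm F n)) where
  carrier := {g | ∀ x, (g : (Idx n → F) ≃ₗ[F] (Idx n → F)) x ∈ lattice F n ↔ x ∈ lattice F n}
  mul_mem' {g h} hg hh x := by
    rw [Subgroup.coe_mul, LinearEquiv.mul_apply, hg, hh]
  one_mem' _ := Iff.rfl
  inv_mem' {g} hg x := by
    rw [← hg, ← LinearEquiv.mul_apply, ← Subgroup.coe_mul, mul_inv_cancel]
    rfl

variable {F}

/-- A uniformizer as a unit of `F`. -/
noncomputable def uniformizerUnit {ϖ : 𝒪[F]} (hϖ : Irreducible ϖ) : Fˣ :=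
  Units.mk0 (ϖ : F) fun h => hϖ.ne_zero (Subtype.ext h)

/-- The factors by which `𝓑'` differs from the standard basis: `1` for `e_i`, `ϖ` for `f_i`, `v₀`. -/
noncomputable def scaling {ϖ : 𝒪[F]} (hϖ : Irreducible ϖ) (n : ℕ) : Idx n → Fˣ :=
  Sum.elim (Sum.elim (fun _ => 1) (fun _ => uniformizerUnit hϖ)) (fun _ => uniformizerUnit hϖ)

/-- The basis `𝓑' = (e_i, f'_i = ϖ f_i, v'₀ = ϖ v₀)`, an `𝒪`-basis of `L`. -/
noncomputable def latticeBasis {ϖ : 𝒪[F]} (hϖ : Irreducible ϖ) (n : ℕ) :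
    Module.Basis (Idx n) F (Idx n → F) :=
  (Pi.basisFun F (Idx n)).unitsSMul (scaling hϖ n)

theorem latticeBasis_apply {ϖ : 𝒪[F]} (hϖ : Irreducible ϖ) {n : ℕ} (i : Idx n) :
    latticeBasis hϖ n i = (scaling hϖ n i : F) • Pi.single i 1 := by
  rw [latticeBasis, Module.Basis.unitsSMul_apply, Pi.basisFun_apply]
  rfl

theorem latticeBasis_repr {ϖ : 𝒪[F]} (hϖ : Irreducible ϖ) {n : ℕ} (x : Idx n → F) (i : Idx n) :
    (latticeBasis hϖ n).repr x i = ((scaling hϖ n i)⁻¹ : Fˣ) * x i := by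
  rw [latticeBasis, Module.Basis.repr_unitsSMul, Pi.basisFun_repr]
  rfl

theorem eq_scaling_mul_repr {ϖ : 𝒪[F]} (hϖ : Irreducible ϖ) {n : ℕ} (x : Idx n → F) (i : Idx n) :
    x i = scaling hϖ n i * (latticeBasis hϖ n).repr x i := by
  rw [latticeBasis_repr, ← mul_assoc, Units.mul_inv, one_mul]

theorem mem_lattice_iff {ϖ : 𝒪[F]} (hϖ : Irreducible ϖ) {n : ℕ} (x : Idx n → F) :
    x ∈ lattice F n ↔ ∀ i, (latticeBasis hϖ n).repr x i ∈ 𝒪[F] := by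
  simp only [lattice, Submodule.mem_pi, Set.mem_univ, true_implies]
  refine forall_congr' fun i => ?_
  have hm : ∀ y : F, y ∈ Submodule.map (Algebra.linearMap 𝒪[F] F) 𝓂[F] ↔
      ((uniformizerUnit hϖ)⁻¹ : Fˣ) * y ∈ 𝒪[F] := by
    intro y
    rw [Submodule.mem_map, hϖ.maximalIdeal_eq]
    constructor
    · rintro ⟨a, ha, rfl⟩
      obtain ⟨b, rfl⟩ := Ideal.mem_span_singleton'.mp ha
      have : ((uniformizerUnit hϖ)⁻¹ : Fˣ) * Algebra.linearMap 𝒪[F] F (b * ϖ) = (b : F) := by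
        rw [Units.inv_mul_eq_iff_eq_mul, mul_comm b]
        rfl
      rw [this]
      exact b.2
    · intro h
      refine ⟨ϖ * ⟨_, h⟩, Ideal.mem_span_singleton.mpr (dvd_mul_right _ _), ?_⟩
      exact Units.mul_inv_cancel_left (uniformizerUnit hϖ) y
  rw [latticeBasis_repr]
  rcases i with (i | i) | i
  · simp only [latticeIdeal, scaling, Sum.elim_inl, inv_one, Units.val_one, one_mul]
    rw [Submodule.mem_map]
    exact ⟨fun ⟨a, _, ha⟩ => ha ▸ a.2, fun h => ⟨⟨_, h⟩, trivial, rfl⟩⟩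
  · exact hm _
  · exact hm _

theorem toMatrix_mem_integer {ϖ : 𝒪[F]} (hϖ : Irreducible ϖ) {n : ℕ} (g : epiparamodular F n)
    (i j : Idx n) :
    LinearMap.toMatrix (latticeBasis hϖ n) (latticeBasis hϖ n)
      (((g : specialOrthogonalGroup (splitForm F n)) : (Idx n → F) ≃ₗ[F] (Idx n → F)) :
        (Idx n → F) →ₗ[F] (Idx n → F)) i j ∈ 𝒪[F] := by
  classical
  rw [LinearMap.toMatrix_apply]
  refine (mem_lattice_iff hϖ _).mp ((g.2 _).mpr ((mem_lattice_iff hϖ _).mpr fun k => ?_)) i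
  rw [Module.Basis.repr_self, Finsupp.single_apply]
  split_ifs
  · exact one_mem _
  · exact zero_mem _

/-- The matrix in the basis `𝓑'` of an element of `J`, which has coefficients in `𝒪`. -/
noncomputable def integralMatrix {ϖ : 𝒪[F]} (hϖ : Irreducible ϖ) (n : ℕ) :
    epiparamodular F n →* Matrix (Idx n) (Idx n) 𝒪[F] where
  toFun g := Matrix.of fun i j => ⟨_, toMatrix_mem_integer hϖ g i j⟩
  map_one' := by
    apply Matrix.map_injective (f := ((↑) : 𝒪[F] → F)) Subtype.val_injective
    refine Eq.trans ?_ (Matrix.map_one ((↑) : 𝒪[F] → F) rfl rfl).symm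
    exact LinearMap.toMatrix_id (latticeBasis hϖ n)
  map_mul' g h := by
    apply Matrix.map_injective (f := 𝒪[F].subtype) Subtype.val_injective
    refine Eq.trans ?_ (Matrix.map_mul (f := 𝒪[F].subtype)).symm
    exact LinearMap.toMatrix_mul (latticeBasis hϖ n) _ _

/-- The reduction modulo `𝔭` of the matrix in the basis `𝓑'`, describing the action `π(g)` on
`V'_k = L / 𝔭L`. -/
noncomputable def reducedMatrix {ϖ : 𝒪[F]} (hϖ : Irreducible ϖ) (n : ℕ) :
    epiparamodular F n →* Matrix (Idx n) (Idx n) 𝓀[F] :=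
  ((IsLocalRing.residue 𝒪[F]).mapMatrix : Matrix (Idx n) (Idx n) 𝒪[F] →+*
    Matrix (Idx n) (Idx n) 𝓀[F]).toMonoidHom.comp (integralMatrix hϖ n)

open Matrix in
/-- Integral matrices of elements of `J` preserve `q' = q / ϖ`, that is,
`∑ x_i y_i + ϖ t²` in the basis `𝓑'`. -/
theorem integralMatrix_isometry {ϖ : 𝒪[F]} (hϖ : Irreducible ϖ) {n : ℕ} (g : epiparamodular F n)
    (x : Idx n → 𝒪[F]) :
    hyperbolicForm 𝒪[F] n ((integralMatrix hϖ n g *ᵥ x) ∘ Sum.inl) +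
        ϖ * ((integralMatrix hϖ n g *ᵥ x) (Sum.inr ()) * (integralMatrix hϖ n g *ᵥ x) (Sum.inr ()))
      = hyperbolicForm 𝒪[F] n (x ∘ Sum.inl) + ϖ * (x (Sum.inr ()) * x (Sum.inr ())) := by
  have key : ∀ (v : Idx n → F) (y : Idx n → 𝒪[F]),
      (∀ i, (latticeBasis hϖ n).repr v i = y i) →
      splitForm F n v = (ϖ : F) * ((hyperbolicForm 𝒪[F] n (y ∘ Sum.inl) +
        ϖ * (y (Sum.inr ()) * y (Sum.inr ())) : 𝒪[F]) : F) := by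
    intro v y h
    have h' : ∀ i, v i = scaling hϖ n i * y i := fun i => by
      rw [← h i]; exact eq_scaling_mul_repr hϖ v i
    have hs : ((uniformizerUnit hϖ : Fˣ) : F) = ϖ := rfl
    rw [splitForm_apply, hyperbolicForm_apply]
    simp only [h', scaling, Sum.elim_inl, Sum.elim_inr, Units.val_one, hs, Function.comp_apply]
    push_cast
    rw [mul_add, Finset.mul_sum]
    congr 1
    · exact Finset.sum_congr rfl fun i _ => by ring
    · ring
  set G := (((g : specialOrthogonalGroup (splitForm F n)) : (Idx n → F) ≃ₗ[F] (Idx n → F)) :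
        (Idx n → F) →ₗ[F] (Idx n → F)) with hG
  let v : Idx n → F := (latticeBasis hϖ n).equivFun.symm fun i => (x i : F)
  have hv : ∀ i, (latticeBasis hϖ n).repr v i = x i := fun i =>
    congrFun ((latticeBasis hϖ n).equivFun.apply_symm_apply fun i => (x i : F)) i
  have hgv : ∀ i, (latticeBasis hϖ n).repr (G v) i = (integralMatrix hϖ n g *ᵥ x) i := by
    intro i
    have h1 := congrFun (LinearMap.toMatrix_mulVec_repr (latticeBasis hϖ n) (latticeBasis hϖ n)
      G v) i
    rw [← h1]
    simp only [Matrix.mulVec, dotProduct, hv]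
    push_cast
    rfl
  have h1 := key v x hv
  have h2 := key (G v) _ hgv
  have h3 : splitForm F n (G v) = splitForm F n v := g.1.2.1 v
  rw [h3, h1] at h2
  have hϖ0 : (ϖ : F) ≠ 0 := fun h => hϖ.ne_zero (Subtype.ext h)
  exact (Subtype.ext (mul_left_cancel₀ hϖ0 h2)).symm

open Matrix in
/-- The reduced matrices preserve the degenerate form `q' ⊗ k`. -/
theorem reducedMatrix_isometry {ϖ : 𝒪[F]} (hϖ : Irreducible ϖ) {n : ℕ} (g : epiparamodular F n)
    (x : Idx n → 𝓀[F]) :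
    hyperbolicForm 𝓀[F] n ((reducedMatrix hϖ n g *ᵥ x) ∘ Sum.inl) =
      hyperbolicForm 𝓀[F] n (x ∘ Sum.inl) := by
  choose y hy using fun i => IsLocalRing.residue_surjective (x i)
  have h := congrArg (IsLocalRing.residue 𝒪[F]) (integralMatrix_isometry hϖ g y)
  have hϖ0 : IsLocalRing.residue 𝒪[F] ϖ = 0 :=
    (IsLocalRing.residue_eq_zero_iff _).mpr hϖ.not_isUnit
  have hM : ∀ i, (reducedMatrix hϖ n g *ᵥ x) i =
      IsLocalRing.residue 𝒪[F] ((integralMatrix hϖ n g *ᵥ y) i) := by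
    intro i
    rw [RingHom.map_mulVec]
    have hxy : x = IsLocalRing.residue 𝒪[F] ∘ y := funext fun j => (hy j).symm
    rw [hxy]
    rfl
  simp only [map_add, map_mul, hϖ0, zero_mul, add_zero, hyperbolicForm_apply, map_sum,
    Function.comp_apply, ← hM, hy] at h
  simpa only [hyperbolicForm_apply, Function.comp_apply] using h

open Matrix in
/-- The kernel `k v'₀` of `q' ⊗ k` is stable under the reduced matrices. -/
theorem reducedMatrix_inl_inr {ϖ : 𝒪[F]} (hϖ : Irreducible ϖ) {n : ℕ} (g : epiparamodular F n)
    (i : Fin n ⊕ Fin n) : reducedMatrix hϖ n g (Sum.inl i) (Sum.inr ()) = 0 := by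
  have hpol : ∀ x y : Idx n → 𝓀[F],
      QuadraticMap.polar (hyperbolicForm 𝓀[F] n) ((reducedMatrix hϖ n g *ᵥ x) ∘ Sum.inl)
        ((reducedMatrix hϖ n g *ᵥ y) ∘ Sum.inl) =
      QuadraticMap.polar (hyperbolicForm 𝓀[F] n) (x ∘ Sum.inl) (y ∘ Sum.inl) := by
    intro x y
    have e : (reducedMatrix hϖ n g *ᵥ x) ∘ Sum.inl + (reducedMatrix hϖ n g *ᵥ y) ∘ Sum.inl =
        (reducedMatrix hϖ n g *ᵥ (x + y)) ∘ (Sum.inl : Fin n ⊕ Fin n → Idx n) := by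
      rw [Matrix.mulVec_add]; rfl
    have e' : (x + y) ∘ (Sum.inl : Fin n ⊕ Fin n → Idx n) = x ∘ Sum.inl + y ∘ Sum.inl := rfl
    rw [QuadraticMap.polar, e, reducedMatrix_isometry, reducedMatrix_isometry,
      reducedMatrix_isometry, e', QuadraticMap.polar]
  have h0 : (reducedMatrix hϖ n g *ᵥ Pi.single (Sum.inr ()) 1) ∘ Sum.inl =
      (0 : Fin n ⊕ Fin n → 𝓀[F]) := by
    refine eq_zero_of_polar_hyperbolicForm _ fun y => ?_
    have h1 : reducedMatrix hϖ n g *ᵥ (reducedMatrix hϖ n g⁻¹ *ᵥ Sum.elim y 0) = Sum.elim y 0 := by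
      rw [Matrix.mulVec_mulVec, ← map_mul, mul_inv_cancel, map_one, Matrix.one_mulVec]
    have h2 := hpol (Pi.single (Sum.inr ()) 1) (reducedMatrix hϖ n g⁻¹ *ᵥ Sum.elim y 0)
    rw [h1] at h2
    have h3 : (Pi.single (Sum.inr ()) 1 : Idx n → 𝓀[F]) ∘ Sum.inl = 0 := by
      funext j; simp
    rw [h3] at h2
    simpa [polar_hyperbolicForm] using h2
  simpa using congrFun h0 i

/-- The matrix of `ḡ` on `V'_k / k v'₀`, in the basis given by the images of the `e_i`, `f'_i`. -/
noncomputable def quotientMatrix {ϖ : 𝒪[F]} (hϖ : Irreducible ϖ) (n : ℕ) :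
    epiparamodular F n →* Matrix (Fin n ⊕ Fin n) (Fin n ⊕ Fin n) 𝓀[F] where
  toFun g := (reducedMatrix hϖ n g).submatrix Sum.inl Sum.inl
  map_one' := by
    rw [map_one, Matrix.submatrix_one _ Sum.inl_injective]
  map_mul' g h := by
    ext i j
    simp [Matrix.mul_apply, Fintype.sum_sum_type, reducedMatrix_inl_inr]

/-- The homomorphism `π̄ : J → O(V'_k / k v'₀, q̄')`, `g ↦ ḡ`. -/
noncomputable def reduction {ϖ : 𝒪[F]} (hϖ : Irreducible ϖ) (n : ℕ) :
    epiparamodular F n →* orthogonalGroup (hyperbolicForm 𝓀[F] n) :=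
  MonoidHom.codRestrict
    ((LinearMap.GeneralLinearGroup.generalLinearEquiv 𝓀[F] (Fin n ⊕ Fin n → 𝓀[F])).toMonoidHom.comp
      (MonoidHom.toHomUnits ((Matrix.toLinAlgEquiv' :
        Matrix (Fin n ⊕ Fin n) (Fin n ⊕ Fin n) 𝓀[F] ≃ₐ[𝓀[F]] _).toMonoidHom.comp
          (quotientMatrix hϖ n)))) _ (by
    intro g x
    have h := reducedMatrix_isometry hϖ g (Sum.elim x 0)
    rw [Sum.elim_comp_inl] at h
    refine Eq.trans ?_ h
    congr 1
    funext i
    change Matrix.mulVec _ x i = _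
    simp [Matrix.mulVec, dotProduct, quotientMatrix])

/-- The paramodular subgroup `J⁺` of `J`: the kernel of `α = d ∘ π̄ : J → {±1}`. -/
noncomputable def paramodular {ϖ : 𝒪[F]} (hϖ : Irreducible ϖ) (n : ℕ) :
    Subgroup (epiparamodular F n) :=
  (signDetKer (hyperbolicForm 𝓀[F] n)).comap (reduction hϖ n)

theorem mem_paramodular_iff {ϖ : 𝒪[F]} (hϖ : Irreducible ϖ) {n : ℕ} (g : epiparamodular F n) :
    g ∈ paramodular hϖ n ↔ signDet (hyperbolicForm 𝓀[F] n) (reduction hϖ n g) = 1 :=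
  Iff.rfl

/-- The character `η ∘ ν : SO(V_n, q) → {±1}`. -/
noncomputable def etaSpinorNorm (F : Type*) [Field F] [ValuativeRel F] [TopologicalSpace F]
    [IsNonarchimedeanLocalField F] [CharZero F] (n : ℕ) :
    specialOrthogonalGroup (splitForm F n) →* ℤˣ :=
  (etaBar F).comp (spinorNorm (splitForm F n) (splitForm_separatingLeft F n))

end LocalField

end Paramodular

open Paramodular

/-!
The identity `η(ν(g)) = d(ḡ)` is proved for every isometry `g ∈ O(V_n, q)` preserving the lattice
`L`, without a condition on the determinant (`IsIntegral.hasSpinorParity`). Both sides are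
multiplicative in `g`, so it suffices to treat generators of the stabilizer of `L` in the full
orthogonal group, and three kinds are enough.

* Reflections along `x ∈ L` with `q'(x) ∈ 𝒪ˣ`. Here `q(x) = ϖ q'(x)` has odd order, and the
  reduction is a reflection of `W`: both sides are `-1`.
* The reflection along `v'₀`. Here `q(v'₀) = ϖ²`, and the reduction is the identity.
* Eichler transformations of `(L, q')`. Their spinor norm is trivial, since they are squares of
  Eichler transformations of `V_n`, and their reductions are Eichler transformations of `W`.

Eichler transformations cannot be left out: for `n = 2` and `k = 𝔽₂` the group `O(W)` is not
generated by reflections.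

Generation is an induction on the number of hyperbolic planes not yet fixed. If `u = g e_i` has unit
coordinate along `f'_i`, the reflection along `u - e_i` takes `u` to `e_i`, and an Eichler
transformation along `e_i` then takes the image of `f'_i` to `f'_i`. The coordinate can be made a
unit by a swap of `e_i` and `f'_i` or by an Eichler transformation, since `⟨u, g f'_i⟩ = 1` and the
contribution of `v'₀` to this product lies in `𝔭`.

On the side of `W`, the sign `d` is computed through the Clifford algebra. A reflection is
implemented by twisted conjugation by a vector, an Eichler transformation by that by `1 + s e`, so
the sign attached to a product of generators is the degree of an implementing unit `z`
(`HasParity`). In characteristic different from `2` this sign is the determinant. In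
characteristic `2`, a unit `z` of even degree commutes with the centre of the even Clifford algebra,
whereas the central element `ζ = ∑ e_i f_i` satisfies `ζ z = z (ζ + 1)` for `z` of odd degree. Hence
the Dickson--Dieudonné determinant is `1` exactly when the degree is even (`HasParity.signDet_eq`),
and a complete description of the centre is not needed.
-/

namespace Paramodular

/-! ### Eichler transformations -/

section Eichler

variable {R M : Type*} [CommRing R] [AddCommGroup M] [Module R M]

/-- The Eichler (or Siegel) transformation
`y ↦ y + ⟨e, y⟩ s - ⟨s, y⟩ e - q(s) ⟨e, y⟩ e` attached to an isotropic vector `e` and a vector `s`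
orthogonal to it. It is encoded as a product of two transvections, which makes it visibly invertible
and of determinant `1` over any commutative ring. -/
def eichler (q : QuadraticForm R M) {e s : M} (he : q e = 0) (hes : QuadraticMap.polar q e s = 0) :
    orthogonalGroup q :=
  ⟨LinearEquiv.transvection (f := q s • q.polarBilin e - q.polarBilin s) (v := e)
      (by simp [QuadraticMap.polar_self, he, QuadraticMap.polar_comm q s e, hes]) *
    LinearEquiv.transvection (f := q.polarBilin e) (v := s) (by simpa using hes), fun y => by
    simp only [LinearEquiv.mul_apply, LinearEquiv.transvection.apply, LinearMap.sub_apply,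
      LinearMap.smul_apply, QuadraticMap.polarBilin_apply_apply, QuadraticMap.map_add q,
      QuadraticMap.polar_add_left, QuadraticMap.polar_add_right, QuadraticMap.polar_smul_left,
      QuadraticMap.polar_smul_right, QuadraticMap.map_smul, QuadraticMap.polar_self, hes, he,
      QuadraticMap.polar_comm q s e, QuadraticMap.polar_comm q y, smul_eq_mul, nsmul_eq_mul]
    push_cast
    ring⟩

theorem eichler_apply (q : QuadraticForm R M) {e s : M} (he : q e = 0)
    (hes : QuadraticMap.polar q e s = 0) (y : M) :
    (eichler q he hes : M ≃ₗ[R] M) y = y + QuadraticMap.polar q e y • s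
      - QuadraticMap.polar q s y • e - (q s * QuadraticMap.polar q e y) • e := by
  simp only [eichler, LinearEquiv.mul_apply, LinearEquiv.transvection.apply, LinearMap.sub_apply,
    LinearMap.smul_apply, QuadraticMap.polarBilin_apply_apply, QuadraticMap.polar_add_right,
    QuadraticMap.polar_smul_right, hes, QuadraticMap.polar_self, smul_eq_mul, nsmul_eq_mul]
  module

theorem det_eichler (q : QuadraticForm R M) {e s : M} (he : q e = 0)
    (hes : QuadraticMap.polar q e s = 0) :
    LinearEquiv.det (eichler q he hes : M ≃ₗ[R] M) = 1 := by
  simp [eichler]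

theorem eichler_mul (q : QuadraticForm R M) {e s t : M} (he : q e = 0)
    (hes : QuadraticMap.polar q e s = 0) (het : QuadraticMap.polar q e t = 0) :
    eichler q he hes * eichler q he het =
      eichler q he (s := s + t) (by rw [QuadraticMap.polar_add_right, hes, het, add_zero]) := by
  ext y
  simp only [Subgroup.coe_mul, LinearEquiv.mul_apply, eichler_apply, QuadraticMap.polar_add_right,
    QuadraticMap.polar_sub_right, QuadraticMap.polar_add_left, QuadraticMap.polar_smul_right, hes,
    het, he, QuadraticMap.polar_self, QuadraticMap.map_add q s t, QuadraticMap.polar_comm q s e,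
    smul_eq_mul, nsmul_eq_mul]
  module

end Eichler

section SpinorNorm

variable {K V : Type*} [Field K] [CharZero K] [AddCommGroup V] [Module K V] [FiniteDimensional K V]

/-- An Eichler transformation is the square of one with `s` halved, so its spinor norm is
trivial. -/
theorem spinorNormO_eichler (q : QuadraticForm K V) (hq : q.polarBilin.SeparatingLeft) {e s : V}
    (he : q e = 0) (hes : QuadraticMap.polar q e s = 0) :
    spinorNormO q hq (eichler q he hes) = 1 := by
  have h : QuadraticMap.polar q e ((2 : K)⁻¹ • s) = 0 := by
    rw [QuadraticMap.polar_smul_right, hes, smul_zero]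
  have h2 : eichler q he hes = eichler q he h * eichler q he h := by
    rw [eichler_mul]
    congr 1
    rw [← add_smul, ← two_mul, mul_inv_cancel₀ two_ne_zero, one_smul]
  rw [h2, map_mul, SquareClass.mul_self]

end SpinorNorm

/-! ### Isometries implemented by elements of the Clifford algebra -/

section Parity

open CliffordAlgebra

variable {k W : Type*} [Field k] [AddCommGroup W] [Module k W] {r : QuadraticForm k W}

/-- `h` has determinant `ε = (-1) ^ i` and is implemented by twisted conjugation by a unit of degree
`i` of the Clifford algebra. Unlike `signDet`, this relation is visibly multiplicative, in every
characteristic. -/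
def HasParity (h : orthogonalGroup r) (ε : ℤˣ) : Prop :=
  ((LinearEquiv.det (h : W ≃ₗ[k] W) : kˣ) : k) = ((ε : ℤ) : k) ∧
    ∃ i : ℕ, ε = (-1) ^ i ∧ ∃ z : (CliffordAlgebra r)ˣ, (z : CliffordAlgebra r) ∈ evenOdd r i ∧
      ∀ x, ι r ((h : W ≃ₗ[k] W) x) * z = ε • (z * ι r x)

theorem HasParity.one : HasParity (1 : orthogonalGroup r) 1 :=
  ⟨by simp, 0, by simp, 1, by simpa using SetLike.one_mem_graded (evenOdd r), fun x => by simp⟩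

theorem HasParity.mul {h h' : orthogonalGroup r} {ε ε' : ℤˣ} (H : HasParity h ε)
    (H' : HasParity h' ε') : HasParity (h * h') (ε * ε') := by
  obtain ⟨hd, i, hi, z, hz, hc⟩ := H
  obtain ⟨hd', i', hi', z', hz', hc'⟩ := H'
  refine ⟨by simp [hd, hd'], i + i', by rw [hi, hi', pow_add], z * z', ?_, fun x => ?_⟩
  · rw [Nat.cast_add, Units.val_mul]
    exact SetLike.mul_mem_graded hz hz'
  · rw [Subgroup.coe_mul, LinearEquiv.mul_apply, Units.val_mul, ← mul_assoc, hc, smul_mul_assoc,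
      mul_assoc, hc', mul_smul_comm, smul_smul, mul_assoc]

theorem det_reflection [FiniteDimensional k W] (x : {x : W // r x ≠ 0}) :
    ((LinearEquiv.det (reflection r x : W ≃ₗ[k] W) : kˣ) : k) = -1 := by
  have h : ((reflection r x : W ≃ₗ[k] W) : W →ₗ[k] W) =
      LinearMap.transvection (-coroot r (x : W)) (x : W) := by
    ext y
    rw [LinearMap.transvection.apply, LinearEquiv.coe_coe, reflection_apply, sub_eq_add_neg,
      ← neg_smul]
    rfl
  rw [LinearEquiv.coe_det, h, LinearMap.transvection.det, LinearMap.neg_apply, coroot_self]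
  norm_num

theorem ι_mul_ι_eq_sub (a b : W) :
    ι r a * ι r b = algebraMap k _ (QuadraticMap.polar r b a) - ι r b * ι r a := by
  rw [QuadraticMap.polar_comm, ← ι_mul_ι_add_swap, add_sub_cancel_right]

theorem hasParity_reflection [FiniteDimensional k W] (x : {x : W // r x ≠ 0}) :
    HasParity (reflection r x) (-1) := by
  have hs : ι r (x : W) * ((r x)⁻¹ • ι r (x : W)) = 1 := by
    rw [mul_smul_comm, ι_sq_scalar, Algebra.smul_def, ← map_mul, inv_mul_cancel₀ x.2, map_one]
  refine ⟨by rw [det_reflection]; simp, 1, by simp,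
    ⟨ι r x, (r x)⁻¹ • ι r x, hs, by rwa [smul_mul_assoc, ← mul_smul_comm]⟩,
    by simpa using ι_mem_evenOdd_one r (x : W), fun y => ?_⟩
  have hx := x.2
  change ι r ((reflection r x : W ≃ₗ[k] W) y) * ι r x = (-1 : ℤˣ) • (ι r x * ι r y)
  rw [reflection_apply, map_sub, map_smul, sub_mul, smul_mul_assoc, ι_sq_scalar, Algebra.smul_def,
    ← map_mul (algebraMap k _), ι_mul_ι_eq_sub y, mul_right_comm, inv_mul_cancel₀ hx, one_mul,
    sub_sub_cancel_left]
  simp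

theorem hasParity_eichler {e s : W} (he : r e = 0) (hes : QuadraticMap.polar r e s = 0) :
    HasParity (eichler r he hes) 1 := by
  have hee : ι r e * ι r e = 0 := by rw [ι_sq_scalar, he, map_zero]
  have hse : ι r e * ι r s = -(ι r s * ι r e) := by
    rw [ι_mul_ι_eq_sub, QuadraticMap.polar_comm, hes, map_zero, zero_sub]
  have hss : ι r s * ι r s = algebraMap k _ (r s) := ι_sq_scalar r s
  have hsq : (ι r s * ι r e) * (ι r s * ι r e) = 0 := by
    rw [mul_assoc, ← mul_assoc (ι r e), hse, neg_mul, mul_assoc, hee, mul_zero, neg_zero, mul_zero]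
  refine ⟨by simp [det_eichler], 0, by simp, ⟨1 + ι r s * ι r e, 1 - ι r s * ι r e,
    by rw [mul_sub, add_mul 1, add_mul 1, hsq]; simp,
      by rw [mul_add, sub_mul 1, sub_mul 1, hsq]; simp⟩, ?_, fun y => ?_⟩
  · rw [Nat.cast_zero]
    exact add_mem (SetLike.one_mem_graded (evenOdd r)) (ι_mul_ι_mem_evenOdd_zero r s e)
  · have h1 : ι r s * ι r e * ι r y = algebraMap k _ (QuadraticMap.polar r e y) * ι r s
        - algebraMap k _ (QuadraticMap.polar r s y) * ι r e + ι r y * ι r s * ι r e := by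
      rw [mul_assoc, ι_mul_ι_eq_sub e y, QuadraticMap.polar_comm r y e, mul_sub,
        ← Algebra.commutes, ← mul_assoc, ι_mul_ι_eq_sub s y, QuadraticMap.polar_comm r y s, sub_mul]
      abel
    have h2 : ι r e * (ι r s * ι r e) = 0 := by
      rw [← mul_assoc, hse, neg_mul, mul_assoc, hee, mul_zero, neg_zero]
    rw [eichler_apply, one_smul]
    simp only [map_add, map_sub, map_smul, Algebra.smul_def]
    change _ * (1 + ι r s * ι r e) = (1 + ι r s * ι r e) * _
    rw [add_mul 1, h1, mul_add, mul_one, sub_mul, sub_mul, add_mul]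
    simp only [mul_assoc, h2, mul_zero]
    rw [← mul_assoc (ι r s), hss, ← mul_assoc (algebraMap k _ (QuadraticMap.polar r e y)),
      ← map_mul (algebraMap k _), mul_comm (r s)]
    rw [one_mul, sub_zero, sub_zero]
    abel

/-- If conjugation by `z`, without a sign, induces `h` on vectors, then it is the action of `h` on
the whole Clifford algebra. -/
theorem map_mul_eq_of_implements (h : orthogonalGroup r) (z : (CliffordAlgebra r)ˣ)
    (hz : ∀ x, ι r ((h : W ≃ₗ[k] W) x) * z = z * ι r x) (c : CliffordAlgebra r) :
    CliffordAlgebra.map (⟨((h : W ≃ₗ[k] W) : W →ₗ[k] W), h.2⟩ : r →qᵢ r) c * z = z * c := by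
  induction c using CliffordAlgebra.induction with
  | algebraMap a => rw [AlgHom.commutes, Algebra.commutes]
  | ι x => rw [CliffordAlgebra.map_apply_ι]; exact hz x
  | mul a b ha hb => rw [map_mul, mul_assoc, hb, ← mul_assoc, ha, mul_assoc]
  | add a b ha hb => rw [map_add, add_mul, ha, hb, mul_add]

theorem HasParity.det_eq_one_iff (h2 : ringChar k ≠ 2) {h : orthogonalGroup r} {ε : ℤˣ}
    (H : HasParity h ε) : LinearEquiv.det (h : W ≃ₗ[k] W) = 1 ↔ ε = 1 := by
  rw [Units.ext_iff, H.1, Units.val_one]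
  rcases Int.units_eq_one_or ε with rfl | rfl
  · simp
  · simp [Ring.neg_one_ne_one_of_char_ne_two h2, Units.ext_iff]

end Parity

/-! ### The centre of the even Clifford algebra of a hyperbolic form in characteristic two -/

section HyperbolicCenter

open CliffordAlgebra

variable {k : Type*} [Field k] {n : ℕ}

/-- The Clifford algebra is nonzero in every characteristic, because the form is
`x ↦ B(x, x)` for the bilinear form `B(x, y) = ∑ x_i y_{n+i}`, so that the Clifford algebra is
linearly isomorphic to the exterior algebra. -/
theorem nontrivial_cliffordAlgebra_hyperbolicForm :
    Nontrivial (CliffordAlgebra (hyperbolicForm k n)) := by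
  let B : LinearMap.BilinForm k (Fin n ⊕ Fin n → k) :=
    ∑ i, (LinearMap.mul k k).compl₁₂ (LinearMap.proj (Sum.inl i)) (LinearMap.proj (Sum.inr i))
  have hB : B.toQuadraticMap = hyperbolicForm k n - 0 := by
    ext x
    simp [B, hyperbolicForm_apply]
  have : Nontrivial (CliffordAlgebra (0 : QuadraticForm k (Fin n ⊕ Fin n → k))) :=
    inferInstanceAs (Nontrivial (ExteriorAlgebra k (Fin n ⊕ Fin n → k)))
  exact (changeFormEquiv hB).symm.toEquiv.nontrivial

/-- The element `∑ e_i f_i`. In characteristic `2` it generates the centre of the even Clifford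
algebra. -/
noncomputable def hyperbolicCenter (k : Type*) [Field k] (n : ℕ) :
    CliffordAlgebra (hyperbolicForm k n) :=
  ∑ i : Fin n, ι (hyperbolicForm k n) (Pi.single (Sum.inl i) 1) *
    ι (hyperbolicForm k n) (Pi.single (Sum.inr i) 1)

theorem hyperbolicCenter_mul_ι [CharP k 2] (v : Fin n ⊕ Fin n → k) :
    hyperbolicCenter k n * ι _ v = ι _ v * (hyperbolicCenter k n + 1) := by
  classical
  have hC : ∀ c : CliffordAlgebra (hyperbolicForm k n), c + c = 0 := fun c => by
    have : ((2 : k) • c) = 0 := by rw [CharTwo.two_eq_zero, zero_smul]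
    rwa [two_smul] at this
  have hneg : ∀ c : CliffordAlgebra (hyperbolicForm k n), -c = c := fun c =>
    (eq_neg_of_add_eq_zero_left (hC c)).symm
  have key : ∀ j : Fin n ⊕ Fin n, hyperbolicCenter k n * ι _ (Pi.single j 1) =
      ι _ (Pi.single j 1) * (hyperbolicCenter k n + 1) := by
    intro j
    have hterm : ∀ i : Fin n, ι (hyperbolicForm k n) (Pi.single (Sum.inl i) 1) *
        ι (hyperbolicForm k n) (Pi.single (Sum.inr i) 1) * ι _ (Pi.single j 1) =
        ι _ (Pi.single j 1) * (ι (hyperbolicForm k n) (Pi.single (Sum.inl i) 1) *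
          ι (hyperbolicForm k n) (Pi.single (Sum.inr i) 1)) +
        if Sum.elim id id j = i then ι _ (Pi.single j 1) else 0 := by
      intro i
      rw [mul_assoc, ι_mul_ι_eq_sub (Pi.single (Sum.inr i) 1), mul_sub, ← Algebra.commutes,
        ← mul_assoc, ι_mul_ι_eq_sub (Pi.single (Sum.inl i) 1) (Pi.single j 1), sub_mul, ← sub_add,
        mul_assoc, add_comm, sub_eq_add_neg, hneg]
      congr 1
      have h0 : algebraMap k (CliffordAlgebra (hyperbolicForm k n)) 2 = 0 := by
        rw [CharTwo.two_eq_zero, map_zero]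
      rcases j with j | j <;> by_cases hij : j = i <;>
        simp [polar_hyperbolicForm, Pi.single_apply, h0, hij, eq_comm]
    rw [hyperbolicCenter, Finset.sum_mul, Finset.sum_congr rfl fun i _ => hterm i,
      Finset.sum_add_distrib, ← Finset.mul_sum, Finset.sum_ite_eq, if_pos (Finset.mem_univ _),
      mul_add, mul_one]
  have hv : v = ∑ j, v j • Pi.single j (1 : k) := by
    simpa using (pi_eq_sum_univ' v)
  rw [hv, map_sum, Finset.mul_sum, Finset.sum_mul]
  refine Finset.sum_congr rfl fun j _ => ?_
  rw [map_smul, mul_smul_comm, smul_mul_assoc, key]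

theorem hyperbolicCenter_mem_even :
    hyperbolicCenter k n ∈ CliffordAlgebra.even (hyperbolicForm k n) :=
  sum_mem fun _ _ => ι_mul_ι_mem_evenOdd_zero _ _ _

theorem hyperbolicCenter_commutes [CharP k 2] {c : CliffordAlgebra (hyperbolicForm k n)}
    (hc : c ∈ evenOdd (hyperbolicForm k n) 0) :
    hyperbolicCenter k n * c = c * hyperbolicCenter k n := by
  have h2 : (1 + 1 : CliffordAlgebra (hyperbolicForm k n)) = 0 := by
    have : ((2 : k) • (1 : CliffordAlgebra (hyperbolicForm k n))) = 0 := by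
      rw [CharTwo.two_eq_zero, zero_smul]
    rwa [two_smul] at this
  induction c, hc using even_induction with
  | algebraMap a => rw [Algebra.commutes]
  | add x y _ _ hx hy => rw [mul_add, hx, hy, add_mul]
  | ι_mul_ι_mul a b x _ hx =>
    rw [← mul_assoc, ← mul_assoc, hyperbolicCenter_mul_ι, mul_assoc (ι _ a), add_mul,
      hyperbolicCenter_mul_ι, one_mul, ← mul_one (ι _ b), mul_assoc (ι _ b), one_mul, ← mul_add,
      add_assoc, h2, add_zero, mul_one, ← mul_assoc, mul_assoc, hx]
    simp only [mul_assoc]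

theorem hyperbolicCenter_mul_of_odd [CharP k 2] {c : CliffordAlgebra (hyperbolicForm k n)}
    (hc : c ∈ evenOdd (hyperbolicForm k n) 1) :
    hyperbolicCenter k n * c = c * (hyperbolicCenter k n + 1) := by
  induction c, hc using odd_induction with
  | ι v => exact hyperbolicCenter_mul_ι v
  | add x y _ _ hx hy => rw [mul_add, hx, hy, add_mul]
  | ι_mul_ι_mul a b x _ hx =>
    rw [← mul_assoc, hyperbolicCenter_commutes (ι_mul_ι_mem_evenOdd_zero _ a b), mul_assoc, hx,
      ← mul_assoc]

/-- An implementing unit of even degree commutes with the centre of the even Clifford algebra, while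
one of odd degree moves `∑ e_i f_i`. -/
theorem HasParity.fixesEvenCenter_iff (h2 : ringChar k = 2)
    {h : orthogonalGroup (hyperbolicForm k n)} {ε : ℤˣ} (H : HasParity h ε) :
    FixesEvenCenter (hyperbolicForm k n) h ↔ ε = 1 := by
  have : CharP k 2 := ringChar.of_eq h2
  have := nontrivial_cliffordAlgebra_hyperbolicForm (k := k) (n := n)
  obtain ⟨-, i, hi, z, hz, hc⟩ := H
  have hsgn : ∀ c : CliffordAlgebra (hyperbolicForm k n), ε • c = c := fun c => by
    rcases Int.units_eq_one_or ε with rfl | rfl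
    · exact one_smul _ c
    · have : ((2 : k) • c) = 0 := by rw [CharTwo.two_eq_zero, zero_smul]
      rw [two_smul] at this
      simpa using (eq_neg_of_add_eq_zero_left this).symm
  have hmap := map_mul_eq_of_implements h z fun x => (hc x).trans (hsgn _)
  rcases Nat.even_or_odd i with hev | hod
  · have hz0 : (z : CliffordAlgebra (hyperbolicForm k n)) ∈ evenOdd (hyperbolicForm k n) 0 := by
      rwa [(ZMod.natCast_eq_zero_iff_even).mpr hev] at hz
    refine iff_of_true (fun c _ hcc => z.mul_left_inj.mp ?_) (by rw [hi, hev.neg_one_pow])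
    rw [hmap, hcc z hz0]
  · have hz1 : (z : CliffordAlgebra (hyperbolicForm k n)) ∈ evenOdd (hyperbolicForm k n) 1 := by
      rwa [(ZMod.natCast_eq_one_iff_odd).mpr hod] at hz
    refine iff_of_false (fun hf => ?_) (by rw [hi, hod.neg_one_pow]; decide)
    have h1 := hmap (hyperbolicCenter k n)
    rw [hf _ hyperbolicCenter_mem_even fun w hw => hyperbolicCenter_commutes hw,
      hyperbolicCenter_mul_of_odd hz1, z.mul_right_inj, add_eq_left] at h1
    exact one_ne_zero h1

theorem HasParity.signDet_eq {h : orthogonalGroup (hyperbolicForm k n)} {ε : ℤˣ}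
    (H : HasParity h ε) : signDet (hyperbolicForm k n) h = ε := by
  have h1 : signDet (hyperbolicForm k n) h = 1 ↔ ε = 1 := by
    rw [signDet_eq_one_iff]
    split_ifs with h2
    · exact H.fixesEvenCenter_iff h2
    · exact H.det_eq_one_iff h2
  rcases Int.units_eq_one_or ε with rfl | rfl
  · exact h1.mpr rfl
  · exact (Int.units_eq_one_or _).resolve_left fun h' => absurd (h1.mp h') (by decide)

end HyperbolicCenter

/-! ### The lattice and its reduction -/

section Lattice

set_option linter.unusedSectionVars false

variable {F : Type*} [Field F] [ValuativeRel F] [TopologicalSpace F] [IsNonarchimedeanLocalField F]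

/-- The form `q' = q / ϖ` on `L`, which is `∑ x_i y_i + ϖ t²` in the basis `𝓑'`. -/
noncomputable def latticeForm (ϖ : 𝒪[F]) (n : ℕ) : QuadraticForm 𝒪[F] (Idx n → 𝒪[F]) :=
  (hyperbolicForm 𝒪[F] n).comp (LinearMap.funLeft 𝒪[F] 𝒪[F] Sum.inl) +
    ϖ • QuadraticMap.linMulLin (LinearMap.proj (Sum.inr ())) (LinearMap.proj (Sum.inr ()))

theorem latticeForm_apply (ϖ : 𝒪[F]) {n : ℕ} (x : Idx n → 𝒪[F]) :
    latticeForm ϖ n x = hyperbolicForm 𝒪[F] n (x ∘ Sum.inl) +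
      ϖ * (x (Sum.inr ()) * x (Sum.inr ())) := by
  simp [latticeForm, LinearMap.funLeft]

theorem polar_latticeForm (ϖ : 𝒪[F]) {n : ℕ} (x y : Idx n → 𝒪[F]) :
    QuadraticMap.polar (latticeForm ϖ n) x y =
      QuadraticMap.polar (hyperbolicForm 𝒪[F] n) (x ∘ Sum.inl) (y ∘ Sum.inl) +
        2 * ϖ * (x (Sum.inr ()) * y (Sum.inr ())) := by
  simp only [QuadraticMap.polar, latticeForm_apply, hyperbolicForm_apply, Pi.add_apply,
    Function.comp_apply]
  ring

/-- The basis vectors `e_i` and `f'_i` of the lattice. -/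
noncomputable def isotropicVector (F : Type*) [Field F] [ValuativeRel F] [TopologicalSpace F]
    [IsNonarchimedeanLocalField F] {n : ℕ} (c : Fin n ⊕ Fin n) : Idx n → 𝒪[F] :=
  Pi.single (Sum.inl c) 1

theorem isotropicVector_inl {n : ℕ} (c d : Fin n ⊕ Fin n) :
    isotropicVector F c (Sum.inl d) = if d = c then 1 else 0 := by
  simp [isotropicVector, Pi.single_apply]

theorem polar_isotropicVector (ϖ : 𝒪[F]) {n : ℕ} (x : Idx n → 𝒪[F]) (c : Fin n ⊕ Fin n) :
    QuadraticMap.polar (latticeForm ϖ n) x (isotropicVector F c) = x (Sum.inl c.swap) := by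
  rw [polar_latticeForm, polar_hyperbolicForm]
  rcases c with c | c <;> simp [isotropicVector, Pi.single_apply]

theorem latticeForm_isotropicVector (ϖ : 𝒪[F]) {n : ℕ} (c : Fin n ⊕ Fin n) :
    latticeForm ϖ n (isotropicVector F c) = 0 := by
  rw [latticeForm_apply, hyperbolicForm_apply]
  rcases c with c | c <;> simp [isotropicVector, Pi.single_apply]

/-- The embedding `L ⊂ V_n`, with `L` identified with column vectors in the basis `𝓑'`. -/
noncomputable def latticeEmb {ϖ : 𝒪[F]} (hϖ : Irreducible ϖ) (n : ℕ) :
    (Idx n → 𝒪[F]) →ₗ[𝒪[F]] (Idx n → F) where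
  toFun y i := scaling hϖ n i * (y i : F)
  map_add' x y := by
    funext i
    simp [mul_add]
  map_smul' a y := by
    funext i
    simp only [Pi.smul_apply, smul_eq_mul, RingHom.id_apply, Algebra.smul_def]
    exact mul_left_comm _ _ _

theorem latticeEmb_apply {ϖ : 𝒪[F]} (hϖ : Irreducible ϖ) {n : ℕ} (y : Idx n → 𝒪[F]) (i : Idx n) :
    latticeEmb hϖ n y i = scaling hϖ n i * (y i : F) := rfl

theorem latticeEmb_injective {ϖ : 𝒪[F]} (hϖ : Irreducible ϖ) (n : ℕ) :
    Function.Injective (latticeEmb hϖ n) := fun x y h => by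
  funext i
  exact Subtype.ext (mul_left_cancel₀ (Units.ne_zero _) (congrFun h i))

theorem latticeEmb_eq_iff {ϖ : 𝒪[F]} (hϖ : Irreducible ϖ) {n : ℕ} (y : Idx n → 𝒪[F])
    (v : Idx n → F) : v = latticeEmb hϖ n y ↔ ∀ i, (latticeBasis hϖ n).repr v i = y i := by
  rw [funext_iff]
  refine forall_congr' fun i => ?_
  rw [eq_scaling_mul_repr hϖ v i, latticeEmb_apply]
  exact mul_right_inj' (Units.ne_zero _)

theorem mem_lattice_iff_exists {ϖ : 𝒪[F]} (hϖ : Irreducible ϖ) {n : ℕ} (v : Idx n → F) :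
    v ∈ lattice F n ↔ ∃ y, v = latticeEmb hϖ n y := by
  simp only [mem_lattice_iff hϖ, latticeEmb_eq_iff]
  exact ⟨fun h => ⟨fun i => ⟨_, h i⟩, fun i => rfl⟩, fun ⟨y, hy⟩ i => hy i ▸ (y i).2⟩

theorem latticeEmb_single {ϖ : 𝒪[F]} (hϖ : Irreducible ϖ) {n : ℕ} (i : Idx n) :
    latticeEmb hϖ n (Pi.single i 1) = latticeBasis hϖ n i := by
  rw [latticeBasis_apply]
  funext j
  by_cases h : j = i
  · subst h; simp [latticeEmb_apply]
  · simp [latticeEmb_apply, h]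

theorem splitForm_latticeEmb {ϖ : 𝒪[F]} (hϖ : Irreducible ϖ) {n : ℕ} (y : Idx n → 𝒪[F]) :
    splitForm F n (latticeEmb hϖ n y) = (ϖ : F) * (latticeForm ϖ n y : 𝒪[F]) := by
  have hs : ((uniformizerUnit hϖ : Fˣ) : F) = ϖ := rfl
  rw [splitForm_apply, latticeForm_apply, hyperbolicForm_apply]
  simp only [latticeEmb_apply, scaling, Sum.elim_inl, Sum.elim_inr, Units.val_one, hs,
    Function.comp_apply]
  push_cast
  rw [mul_add, Finset.mul_sum]
  congr 1
  · exact Finset.sum_congr rfl fun i _ => by ring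
  · ring

theorem polar_latticeEmb {ϖ : 𝒪[F]} (hϖ : Irreducible ϖ) {n : ℕ} (x y : Idx n → 𝒪[F]) :
    QuadraticMap.polar (splitForm F n) (latticeEmb hϖ n x) (latticeEmb hϖ n y) =
      (ϖ : F) * (QuadraticMap.polar (latticeForm ϖ n) x y : 𝒪[F]) := by
  rw [QuadraticMap.polar, ← map_add, splitForm_latticeEmb, splitForm_latticeEmb,
    splitForm_latticeEmb, QuadraticMap.polar]
  push_cast
  ring

theorem latticeForm_eq_of_apply {ϖ : 𝒪[F]} (hϖ : Irreducible ϖ) {n : ℕ}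
    (g : orthogonalGroup (splitForm F n)) {x x' : Idx n → 𝒪[F]}
    (hx : (g : (Idx n → F) ≃ₗ[F] (Idx n → F)) (latticeEmb hϖ n x) = latticeEmb hϖ n x') :
    latticeForm ϖ n x' = latticeForm ϖ n x := by
  have h := g.2 (latticeEmb hϖ n x)
  rw [hx, splitForm_latticeEmb, splitForm_latticeEmb] at h
  exact Subtype.ext (mul_left_cancel₀ (uniformizerUnit hϖ).ne_zero h)

theorem polar_eq_of_apply {ϖ : 𝒪[F]} (hϖ : Irreducible ϖ) {n : ℕ}
    (g : orthogonalGroup (splitForm F n)) {x x' y y' : Idx n → 𝒪[F]}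
    (hx : (g : (Idx n → F) ≃ₗ[F] (Idx n → F)) (latticeEmb hϖ n x) = latticeEmb hϖ n x')
    (hy : (g : (Idx n → F) ≃ₗ[F] (Idx n → F)) (latticeEmb hϖ n y) = latticeEmb hϖ n y') :
    QuadraticMap.polar (latticeForm ϖ n) x' y' = QuadraticMap.polar (latticeForm ϖ n) x y := by
  rw [QuadraticMap.polar, QuadraticMap.polar, latticeForm_eq_of_apply hϖ g hx,
    latticeForm_eq_of_apply hϖ g hy, latticeForm_eq_of_apply hϖ g (x := x + y) (x' := x' + y')
      (by rw [map_add, map_add, hx, hy, map_add])]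

/-- The projection `L → W = (L ⊗ k) / k v'₀`. -/
noncomputable def residueMap (F : Type*) [Field F] [ValuativeRel F] [TopologicalSpace F]
    [IsNonarchimedeanLocalField F] (n : ℕ) :
    (Idx n → 𝒪[F]) →ₛₗ[IsLocalRing.residue 𝒪[F]] (Fin n ⊕ Fin n → 𝓀[F]) where
  toFun y c := IsLocalRing.residue 𝒪[F] (y (Sum.inl c))
  map_add' x y := by
    funext c
    simp
  map_smul' a y := by
    funext c
    simp

theorem residueMap_apply {n : ℕ} (y : Idx n → 𝒪[F]) (c : Fin n ⊕ Fin n) :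
    residueMap F n y c = IsLocalRing.residue 𝒪[F] (y (Sum.inl c)) := rfl

theorem residueMap_surjective (n : ℕ) : Function.Surjective (residueMap F n) := fun x => by
  choose y hy using fun c => IsLocalRing.residue_surjective (R := 𝒪[F]) (x c)
  exact ⟨Sum.elim y 0, funext hy⟩

theorem residue_uniformizer {ϖ : 𝒪[F]} (hϖ : Irreducible ϖ) : IsLocalRing.residue 𝒪[F] ϖ = 0 :=
  (IsLocalRing.residue_eq_zero_iff _).mpr hϖ.not_isUnit

theorem hyperbolicForm_residueMap {ϖ : 𝒪[F]} (hϖ : Irreducible ϖ) {n : ℕ} (y : Idx n → 𝒪[F]) :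
    hyperbolicForm 𝓀[F] n (residueMap F n y) = IsLocalRing.residue 𝒪[F] (latticeForm ϖ n y) := by
  simp [latticeForm_apply, hyperbolicForm_apply, residueMap_apply, residue_uniformizer hϖ]

theorem polar_residueMap {ϖ : 𝒪[F]} (hϖ : Irreducible ϖ) {n : ℕ} (x y : Idx n → 𝒪[F]) :
    QuadraticMap.polar (hyperbolicForm 𝓀[F] n) (residueMap F n x) (residueMap F n y) =
      IsLocalRing.residue 𝒪[F] (QuadraticMap.polar (latticeForm ϖ n) x y) := by
  rw [QuadraticMap.polar, ← map_add, hyperbolicForm_residueMap hϖ, hyperbolicForm_residueMap hϖ,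
    hyperbolicForm_residueMap hϖ, QuadraticMap.polar, map_sub, map_sub]

/-- `g` preserves the lattice `L`. -/
def IsIntegral {ϖ : 𝒪[F]} (hϖ : Irreducible ϖ) {n : ℕ} (g : orthogonalGroup (splitForm F n)) :
    Prop :=
  ∀ y, ∃ y', (g : (Idx n → F) ≃ₗ[F] (Idx n → F)) (latticeEmb hϖ n y) = latticeEmb hϖ n y'

theorem IsIntegral.mul {ϖ : 𝒪[F]} {hϖ : Irreducible ϖ} {n : ℕ}
    {g g' : orthogonalGroup (splitForm F n)} (h : IsIntegral hϖ g) (h' : IsIntegral hϖ g') :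
    IsIntegral hϖ (g * g') := fun y => by
  obtain ⟨y', hy'⟩ := h' y
  obtain ⟨y'', hy''⟩ := h y'
  exact ⟨y'', by rw [Subgroup.coe_mul, LinearEquiv.mul_apply, hy', hy'']⟩

/-- `g` preserves the lattice `L` and induces `h` on `W`. The relation makes sense on all of
`O(V_n, q)`, whereas `reduction` is only defined on `J`, which contains no reflections. -/
def Reduces {ϖ : 𝒪[F]} (hϖ : Irreducible ϖ) {n : ℕ} (g : orthogonalGroup (splitForm F n))
    (h : orthogonalGroup (hyperbolicForm 𝓀[F] n)) : Prop :=
  ∀ y, ∃ y', (g : (Idx n → F) ≃ₗ[F] (Idx n → F)) (latticeEmb hϖ n y) = latticeEmb hϖ n y' ∧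
    residueMap F n y' =
      (h : (Fin n ⊕ Fin n → 𝓀[F]) ≃ₗ[𝓀[F]] (Fin n ⊕ Fin n → 𝓀[F])) (residueMap F n y)

theorem Reduces.isIntegral {ϖ : 𝒪[F]} {hϖ : Irreducible ϖ} {n : ℕ}
    {g : orthogonalGroup (splitForm F n)} {h : orthogonalGroup (hyperbolicForm 𝓀[F] n)}
    (H : Reduces hϖ g h) : IsIntegral hϖ g := fun y => (H y).imp fun _ => And.left

theorem Reduces.mul {ϖ : 𝒪[F]} {hϖ : Irreducible ϖ} {n : ℕ}
    {g g' : orthogonalGroup (splitForm F n)} {h h' : orthogonalGroup (hyperbolicForm 𝓀[F] n)}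
    (H : Reduces hϖ g h) (H' : Reduces hϖ g' h') : Reduces hϖ (g * g') (h * h') := fun y => by
  obtain ⟨y', hy', hr'⟩ := H' y
  obtain ⟨y'', hy'', hr''⟩ := H y'
  exact ⟨y'', by rw [Subgroup.coe_mul, LinearEquiv.mul_apply, hy', hy''],
    by rw [hr'', hr', Subgroup.coe_mul, LinearEquiv.mul_apply]⟩

theorem Reduces.unique {ϖ : 𝒪[F]} {hϖ : Irreducible ϖ} {n : ℕ}
    {g : orthogonalGroup (splitForm F n)} {h h' : orthogonalGroup (hyperbolicForm 𝓀[F] n)}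
    (H : Reduces hϖ g h) (H' : Reduces hϖ g h') : h = h' := by
  refine Subtype.ext (LinearEquiv.ext fun x => ?_)
  obtain ⟨y, rfl⟩ := residueMap_surjective n x
  obtain ⟨z, hz, hr⟩ := H y
  obtain ⟨z', hz', hr'⟩ := H' y
  rw [← hr, ← hr', latticeEmb_injective hϖ n (hz.symm.trans hz')]

open Matrix in
theorem reduces_reduction [CharZero F] {ϖ : 𝒪[F]} (hϖ : Irreducible ϖ) {n : ℕ}
    (g : epiparamodular F n) :
    Reduces hϖ (Subgroup.inclusion inf_le_left (g : specialOrthogonalGroup (splitForm F n)))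
      (reduction hϖ n g) := by
  intro y
  refine ⟨integralMatrix hϖ n g *ᵥ y, (latticeEmb_eq_iff hϖ _ _).mpr fun i => ?_, ?_⟩
  · have hy := (latticeEmb_eq_iff hϖ y _).mp rfl
    have h1 := congrFun (LinearMap.toMatrix_mulVec_repr (latticeBasis hϖ n) (latticeBasis hϖ n)
      (((g : specialOrthogonalGroup (splitForm F n)) : (Idx n → F) ≃ₗ[F] (Idx n → F)) :
        (Idx n → F) →ₗ[F] (Idx n → F)) (latticeEmb hϖ n y)) i
    refine h1.symm.trans ?_
    simp only [Matrix.mulVec, dotProduct, hy]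
    push_cast
    rfl
  · funext c
    rw [residueMap_apply, RingHom.map_mulVec]
    change _ = (quotientMatrix hϖ n g *ᵥ residueMap F n y) c
    change (reducedMatrix hϖ n g *ᵥ (IsLocalRing.residue 𝒪[F] ∘ y)) (Sum.inl c) = _
    simp only [Matrix.mulVec, dotProduct, Fintype.sum_sum_type, Fintype.sum_unique]
    have h0 : reducedMatrix hϖ n g (Sum.inl c) (Sum.inr default) = 0 := reducedMatrix_inl_inr hϖ g c
    rw [h0, zero_mul, add_zero]
    rfl

end Lattice

section SpinorParity

set_option linter.unusedSectionVars false

variable {F : Type*} [Field F] [ValuativeRel F] [TopologicalSpace F] [IsNonarchimedeanLocalField F]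
  [CharZero F]

/-! ### The isometries for which the spinor norm computes the parity -/

/-- `g` preserves `L`, and `η(ν(g))` is the parity of the isometry that `g` induces on `W`. -/
def HasSpinorParity {ϖ : 𝒪[F]} (hϖ : Irreducible ϖ) {n : ℕ} (g : orthogonalGroup (splitForm F n)) :
    Prop :=
  ∃ h, Reduces hϖ g h ∧
    HasParity h (etaBar F (spinorNormO (splitForm F n) (splitForm_separatingLeft F n) g))

theorem HasSpinorParity.mul {ϖ : 𝒪[F]} {hϖ : Irreducible ϖ} {n : ℕ}
    {g g' : orthogonalGroup (splitForm F n)} (H : HasSpinorParity hϖ g)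
    (H' : HasSpinorParity hϖ g') : HasSpinorParity hϖ (g * g') := by
  obtain ⟨h, hr, hp⟩ := H
  obtain ⟨h', hr', hp'⟩ := H'
  refine ⟨h * h', hr.mul hr', ?_⟩
  rw [map_mul, map_mul]
  exact hp.mul hp'

theorem HasSpinorParity.of_mul {ϖ : 𝒪[F]} {hϖ : Irreducible ϖ} {n : ℕ}
    {s t g : orthogonalGroup (splitForm F n)} (hs : HasSpinorParity hϖ s) (hst : s * t = 1)
    (H : HasSpinorParity hϖ (t * g)) : HasSpinorParity hϖ g := by
  have := hs.mul H
  rwa [← mul_assoc, hst, one_mul] at this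

theorem HasSpinorParity.isIntegral {ϖ : 𝒪[F]} {hϖ : Irreducible ϖ} {n : ℕ}
    {g : orthogonalGroup (splitForm F n)} (H : HasSpinorParity hϖ g) : IsIntegral hϖ g :=
  H.choose_spec.1.isIntegral

theorem hasSpinorParity_one {ϖ : 𝒪[F]} (hϖ : Irreducible ϖ) (n : ℕ) :
    HasSpinorParity hϖ (1 : orthogonalGroup (splitForm F n)) := by
  refine ⟨1, fun y => ⟨y, rfl, rfl⟩, ?_⟩
  rw [map_one, map_one]
  exact HasParity.one

theorem splitForm_latticeEmb_ne_zero {ϖ : 𝒪[F]} (hϖ : Irreducible ϖ) {n : ℕ} {x : Idx n → 𝒪[F]}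
    (hx : latticeForm ϖ n x ≠ 0) : splitForm F n (latticeEmb hϖ n x) ≠ 0 := by
  rw [splitForm_latticeEmb]
  exact mul_ne_zero (uniformizerUnit hϖ).ne_zero fun h => hx (Subtype.ext h)

/-- The reflection along an anisotropic vector of `L`. -/
noncomputable def latticeReflection {ϖ : 𝒪[F]} (hϖ : Irreducible ϖ) {n : ℕ} {x : Idx n → 𝒪[F]}
    (hx : latticeForm ϖ n x ≠ 0) : orthogonalGroup (splitForm F n) :=
  reflection (splitForm F n) ⟨latticeEmb hϖ n x, splitForm_latticeEmb_ne_zero hϖ hx⟩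

theorem latticeReflection_mul_self {ϖ : 𝒪[F]} (hϖ : Irreducible ϖ) {n : ℕ} {x : Idx n → 𝒪[F]}
    (hx : latticeForm ϖ n x ≠ 0) : latticeReflection hϖ hx * latticeReflection hϖ hx = 1 :=
  reflection_mul_self _ _

/-- A reflection along a vector of `L` acts on the lattice whenever `q'(x)` divides the values
`⟨x, y⟩`. -/
theorem latticeReflection_apply {ϖ : 𝒪[F]} (hϖ : Irreducible ϖ) {n : ℕ} {x : Idx n → 𝒪[F]}
    (hx : latticeForm ϖ n x ≠ 0) {y : Idx n → 𝒪[F]} {a : 𝒪[F]}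
    (ha : QuadraticMap.polar (latticeForm ϖ n) x y = latticeForm ϖ n x * a) :
    (latticeReflection hϖ hx : (Idx n → F) ≃ₗ[F] (Idx n → F)) (latticeEmb hϖ n y) =
      latticeEmb hϖ n (y - a • x) := by
  have h0 := splitForm_latticeEmb_ne_zero hϖ hx
  rw [latticeReflection, reflection_apply, map_sub, map_smul, Algebra.smul_def]
  congr 1
  have h1 : (splitForm F n (latticeEmb hϖ n x))⁻¹ *
      QuadraticMap.polar (splitForm F n) (latticeEmb hϖ n x) (latticeEmb hϖ n y) = a := by
    rw [inv_mul_eq_iff_eq_mul₀ h0, polar_latticeEmb, ha, splitForm_latticeEmb]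
    push_cast
    ring
  rw [h1]
  rfl

theorem spinorNormO_latticeReflection {ϖ : 𝒪[F]} (hϖ : Irreducible ϖ) {n : ℕ} {x : Idx n → 𝒪[F]}
    (hx : latticeForm ϖ n x ≠ 0) :
    etaBar F (spinorNormO (splitForm F n) (splitForm_separatingLeft F n)
      (latticeReflection hϖ hx)) =
      eta F (Units.mk0 _ (splitForm_latticeEmb_ne_zero hϖ hx)) := by
  rw [latticeReflection, spinorNormO_reflection]
  rfl

theorem eta_latticeReflection_of_isUnit {ϖ : 𝒪[F]} (hϖ : Irreducible ϖ) {n : ℕ}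
    {x : Idx n → 𝒪[F]} (hx : IsUnit (latticeForm ϖ n x)) :
    etaBar F (spinorNormO (splitForm F n) (splitForm_separatingLeft F n)
      (latticeReflection hϖ hx.ne_zero)) = -1 := by
  rw [spinorNormO_latticeReflection]
  refine eta_uniformizer F _ (ϖ * latticeForm ϖ n x) ?_ (splitForm_latticeEmb hϖ x).symm
  exact (irreducible_mul_isUnit hx).mpr hϖ

/-- A reflection along `x` with `q'(x)` a unit reduces to a reflection, and `q(x) = ϖ q'(x)` has odd
order. -/
theorem hasSpinorParity_latticeReflection {ϖ : 𝒪[F]} (hϖ : Irreducible ϖ) {n : ℕ}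
    {x : Idx n → 𝒪[F]} (hx : IsUnit (latticeForm ϖ n x)) :
    HasSpinorParity hϖ (latticeReflection hϖ hx.ne_zero) := by
  have hr : hyperbolicForm 𝓀[F] n (residueMap F n x) ≠ 0 := by
    rw [hyperbolicForm_residueMap hϖ]
    exact (hx.map (IsLocalRing.residue 𝒪[F])).ne_zero
  refine ⟨reflection (hyperbolicForm 𝓀[F] n) ⟨residueMap F n x, hr⟩, fun y => ?_, ?_⟩
  · obtain ⟨u, hu⟩ := hx
    have ha : QuadraticMap.polar (latticeForm ϖ n) x y = latticeForm ϖ n x *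
        ((u⁻¹ : 𝒪[F]ˣ) * QuadraticMap.polar (latticeForm ϖ n) x y) := by
      rw [← hu, Units.mul_inv_cancel_left]
    refine ⟨_, latticeReflection_apply hϖ _ ha, ?_⟩
    rw [reflection_apply, map_sub, map_smulₛₗ, map_mul, polar_residueMap hϖ,
      hyperbolicForm_residueMap hϖ, ← hu, ← map_units_inv]
  · rw [eta_latticeReflection_of_isUnit hϖ hx]
    exact hasParity_reflection _

/-- The basis vector `v'₀` of the lattice. -/
noncomputable def centralVector (F : Type*) [Field F] [ValuativeRel F] [TopologicalSpace F]
    [IsNonarchimedeanLocalField F] (n : ℕ) : Idx n → 𝒪[F] := Pi.single (Sum.inr ()) 1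

theorem latticeForm_centralVector (ϖ : 𝒪[F]) (n : ℕ) :
    latticeForm ϖ n (centralVector F n) = ϖ := by
  simp [latticeForm_apply, hyperbolicForm_apply, centralVector]

theorem polar_centralVector (ϖ : 𝒪[F]) {n : ℕ} (y : Idx n → 𝒪[F]) :
    QuadraticMap.polar (latticeForm ϖ n) (centralVector F n) y =
      latticeForm ϖ n (centralVector F n) * (2 * y (Sum.inr ())) := by
  rw [latticeForm_centralVector, polar_latticeForm, polar_hyperbolicForm]
  simp [centralVector]
  ring

theorem latticeForm_centralVector_ne_zero {ϖ : 𝒪[F]} (hϖ : Irreducible ϖ) (n : ℕ) :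
    latticeForm ϖ n (centralVector F n) ≠ 0 := by
  rw [latticeForm_centralVector]
  exact hϖ.ne_zero

theorem eta_latticeReflection_centralVector {ϖ : 𝒪[F]} (hϖ : Irreducible ϖ) (n : ℕ) :
    etaBar F (spinorNormO (splitForm F n) (splitForm_separatingLeft F n)
      (latticeReflection hϖ (latticeForm_centralVector_ne_zero hϖ n))) = 1 := by
  rw [spinorNormO_latticeReflection]
  have h : Units.mk0 _ (splitForm_latticeEmb_ne_zero hϖ (latticeForm_centralVector_ne_zero hϖ n)) =
      uniformizerUnit hϖ * uniformizerUnit hϖ := by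
    apply Units.ext
    rw [Units.val_mk0, splitForm_latticeEmb, latticeForm_centralVector]
    rfl
  rw [h, map_mul, Int.units_mul_self]

/-- The reflection along `v'₀` induces the identity on `W`, and `q(v'₀) = ϖ²` is a square. -/
theorem hasSpinorParity_centralVector {ϖ : 𝒪[F]} (hϖ : Irreducible ϖ) (n : ℕ) :
    HasSpinorParity hϖ (latticeReflection hϖ (latticeForm_centralVector_ne_zero hϖ n)) := by
  refine ⟨1, fun y => ⟨_, latticeReflection_apply hϖ _ (polar_centralVector ϖ y), ?_⟩, ?_⟩
  · have h0 : residueMap F n (centralVector F n) = 0 := by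
      funext c
      simp [residueMap_apply, centralVector]
    rw [map_sub, map_smulₛₗ, h0, smul_zero, sub_zero]
    rfl
  · rw [eta_latticeReflection_centralVector]
    exact HasParity.one

/-- The Eichler transformation of `(L, q')` attached to vectors `e`, `s` of `L`, extended to `V_n`.
Passing from `q'` to `q = ϖ q'` amounts to dividing `e` by `ϖ`. -/
noncomputable def latticeEichler {ϖ : 𝒪[F]} (hϖ : Irreducible ϖ) {n : ℕ} {e s : Idx n → 𝒪[F]}
    (he : latticeForm ϖ n e = 0) (hes : QuadraticMap.polar (latticeForm ϖ n) e s = 0) :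
    orthogonalGroup (splitForm F n) :=
  eichler (splitForm F n) (e := (ϖ : F)⁻¹ • latticeEmb hϖ n e) (s := latticeEmb hϖ n s)
    (by rw [QuadraticMap.map_smul, splitForm_latticeEmb, he]; simp)
    (by rw [QuadraticMap.polar_smul_left, polar_latticeEmb, hes]; simp)

theorem latticeEichler_apply {ϖ : 𝒪[F]} (hϖ : Irreducible ϖ) {n : ℕ} {e s : Idx n → 𝒪[F]}
    (he : latticeForm ϖ n e = 0) (hes : QuadraticMap.polar (latticeForm ϖ n) e s = 0)
    (y : Idx n → 𝒪[F]) :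
    (latticeEichler hϖ he hes : (Idx n → F) ≃ₗ[F] (Idx n → F)) (latticeEmb hϖ n y) =
      latticeEmb hϖ n ((eichler (latticeForm ϖ n) he hes :
        (Idx n → 𝒪[F]) ≃ₗ[𝒪[F]] (Idx n → 𝒪[F])) y) := by
  have h0 : (ϖ : F) ≠ 0 := (uniformizerUnit hϖ).ne_zero
  have hsm : ∀ (a : 𝒪[F]) (v : Idx n → F), a • v = (a : F) • v := fun _ _ => rfl
  rw [latticeEichler, eichler_apply, eichler_apply, map_sub, map_sub, map_add, map_smul, map_smul,
    map_smul, QuadraticMap.polar_smul_left, polar_latticeEmb, polar_latticeEmb,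
    splitForm_latticeEmb, hsm, hsm, hsm, smul_smul, smul_smul, smul_eq_mul,
    inv_mul_cancel_left₀ h0, mul_right_comm (ϖ : F), mul_inv_cancel₀ h0, one_mul]
  congr 2
  push_cast
  field_simp

theorem hasSpinorParity_latticeEichler {ϖ : 𝒪[F]} (hϖ : Irreducible ϖ) {n : ℕ}
    {e s : Idx n → 𝒪[F]} (he : latticeForm ϖ n e = 0)
    (hes : QuadraticMap.polar (latticeForm ϖ n) e s = 0) :
    HasSpinorParity hϖ (latticeEichler hϖ he hes) := by
  refine ⟨eichler (hyperbolicForm 𝓀[F] n) (e := residueMap F n e) (s := residueMap F n s)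
    (by rw [hyperbolicForm_residueMap hϖ, he, map_zero])
    (by rw [polar_residueMap hϖ, hes, map_zero]),
    fun y => ⟨_, latticeEichler_apply hϖ he hes y, ?_⟩, ?_⟩
  · rw [eichler_apply, eichler_apply, map_sub, map_sub, map_add, map_smulₛₗ, map_smulₛₗ, map_smulₛₗ,
      polar_residueMap hϖ, polar_residueMap hϖ, hyperbolicForm_residueMap hϖ, map_mul]
  · rw [latticeEichler, spinorNormO_eichler, map_one]
    exact hasParity_eichler _ _

theorem latticeEichler_neg_mul {ϖ : 𝒪[F]} (hϖ : Irreducible ϖ) {n : ℕ} {e s : Idx n → 𝒪[F]}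
    (he : latticeForm ϖ n e = 0) (hes : QuadraticMap.polar (latticeForm ϖ n) e s = 0)
    (hes' : QuadraticMap.polar (latticeForm ϖ n) e (-s) = 0) :
    latticeEichler hϖ he hes' * latticeEichler hϖ he hes = 1 := by
  rw [latticeEichler, latticeEichler, eichler_mul]
  ext y
  simp [eichler_apply]

/-! ### Reduction to the generators -/

/-- `g` preserves the lattice and fixes `e_i` and `f'_i` for `i ≥ m`. -/
def FixesFrom {ϖ : 𝒪[F]} (hϖ : Irreducible ϖ) {n : ℕ} (m : ℕ)
    (g : orthogonalGroup (splitForm F n)) : Prop :=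
  IsIntegral hϖ g ∧ ∀ c : Fin n ⊕ Fin n, m ≤ (Sum.elim id id c : Fin n) →
    (g : (Idx n → F) ≃ₗ[F] (Idx n → F)) (latticeEmb hϖ n (isotropicVector F c)) =
      latticeEmb hϖ n (isotropicVector F c)

theorem latticeReflection_apply_of_orthogonal {ϖ : 𝒪[F]} (hϖ : Irreducible ϖ) {n : ℕ}
    {x y : Idx n → 𝒪[F]} (hx : latticeForm ϖ n x ≠ 0)
    (hxy : QuadraticMap.polar (latticeForm ϖ n) x y = 0) :
    (latticeReflection hϖ hx : (Idx n → F) ≃ₗ[F] (Idx n → F)) (latticeEmb hϖ n y) =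
      latticeEmb hϖ n y := by
  rw [latticeReflection_apply hϖ hx (a := 0) (by rw [hxy, mul_zero]), zero_smul, sub_zero]

theorem latticeEichler_apply_of_orthogonal {ϖ : 𝒪[F]} (hϖ : Irreducible ϖ) {n : ℕ}
    {e s y : Idx n → 𝒪[F]} (he : latticeForm ϖ n e = 0)
    (hes : QuadraticMap.polar (latticeForm ϖ n) e s = 0)
    (hey : QuadraticMap.polar (latticeForm ϖ n) e y = 0)
    (hsy : QuadraticMap.polar (latticeForm ϖ n) s y = 0) :
    (latticeEichler hϖ he hes : (Idx n → F) ≃ₗ[F] (Idx n → F)) (latticeEmb hϖ n y) =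
      latticeEmb hϖ n y := by
  rw [latticeEichler_apply, eichler_apply, hey, hsy]
  simp

/-- An isometry that preserves `L` and fixes all `e_i`, `f'_i` sends `v'₀` to `± v'₀`. -/
theorem hasSpinorParity_of_fixesFrom_zero {ϖ : 𝒪[F]} (hϖ : Irreducible ϖ) {n : ℕ}
    {g : orthogonalGroup (splitForm F n)} (hg : FixesFrom hϖ 0 g) : HasSpinorParity hϖ g := by
  obtain ⟨z, hz⟩ := hg.1 (centralVector F n)
  have hz0 : ∀ c, z (Sum.inl c) = 0 := fun c => by
    have h1 := polar_eq_of_apply hϖ g hz (hg.2 c.swap (Nat.zero_le _))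
    rw [polar_isotropicVector, polar_isotropicVector, Sum.swap_swap] at h1
    rw [h1]
    simp [centralVector]
  have hzz : z (Sum.inr ()) * z (Sum.inr ()) = 1 := by
    have h1 := latticeForm_eq_of_apply hϖ g hz
    rw [latticeForm_centralVector, latticeForm_apply, hyperbolicForm_apply] at h1
    simp only [Function.comp_apply, hz0, mul_zero, Finset.sum_const_zero, zero_add] at h1
    exact (mul_eq_left₀ hϖ.ne_zero).mp h1
  have hext : ∀ g' : orthogonalGroup (splitForm F n),
      (∀ c, (g' : (Idx n → F) ≃ₗ[F] (Idx n → F)) (latticeEmb hϖ n (isotropicVector F c)) =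
        latticeEmb hϖ n (isotropicVector F c)) →
      (g' : (Idx n → F) ≃ₗ[F] (Idx n → F)) (latticeEmb hϖ n (centralVector F n)) =
        latticeEmb hϖ n z → g = g' := by
    intro g' h1 h2
    refine Subtype.ext (LinearEquiv.toLinearMap_injective ((latticeBasis hϖ n).ext fun i => ?_))
    rw [← latticeEmb_single]
    rcases i with c | ⟨⟩
    · exact (hg.2 c (Nat.zero_le _)).trans (h1 c).symm
    · exact hz.trans h2.symm
  rcases mul_self_eq_one_iff.mp hzz with h1 | h1
  · have hzv : z = centralVector F n := by
      funext i
      rcases i with c | ⟨⟩ <;> simp [hz0, h1, centralVector]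
    rw [hext 1 (fun c => rfl) (by rw [hzv]; rfl)]
    exact hasSpinorParity_one hϖ n
  · have hzv : z = centralVector F n - (2 : 𝒪[F]) • centralVector F n := by
      funext i
      rcases i with c | ⟨⟩
      · simp [hz0, centralVector]
      · rw [h1]
        simp [centralVector]
        norm_num
    have hgt : g = latticeReflection hϖ (latticeForm_centralVector_ne_zero hϖ n) := by
      refine hext _ (fun c => ?_) ?_
      · refine latticeReflection_apply_of_orthogonal hϖ _ ?_
        rw [polar_centralVector]
        simp [isotropicVector]
      · rw [latticeReflection_apply hϖ _ (polar_centralVector ϖ _), hzv]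
        simp [centralVector]
    rw [hgt]
    exact hasSpinorParity_centralVector hϖ n

/-- If `g` already fixes `e_i`, an Eichler transformation along `e_i` brings `g f'_i` back to
`f'_i`. -/
theorem hasSpinorParity_of_apply_e_eq {ϖ : 𝒪[F]} (hϖ : Irreducible ϖ) {n : ℕ} (i : Fin n)
    (ih : ∀ g : orthogonalGroup (splitForm F n), FixesFrom hϖ i g → HasSpinorParity hϖ g)
    {g : orthogonalGroup (splitForm F n)} (hg : FixesFrom hϖ (i + 1) g)
    (hge : (g : (Idx n → F) ≃ₗ[F] (Idx n → F)) (latticeEmb hϖ n (isotropicVector F (Sum.inl i))) =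
      latticeEmb hϖ n (isotropicVector F (Sum.inl i))) : HasSpinorParity hϖ g := by
  set e := isotropicVector F (Sum.inl i) with he_def
  set f := isotropicVector F (Sum.inr i) with hf_def
  obtain ⟨w, hw⟩ := hg.1 f
  have he : latticeForm ϖ n e = 0 := latticeForm_isotropicVector ϖ _
  have hf : latticeForm ϖ n f = 0 := latticeForm_isotropicVector ϖ _
  have hef : QuadraticMap.polar (latticeForm ϖ n) e f = 1 := by
    rw [hf_def, polar_isotropicVector, he_def, isotropicVector_inl]; simp
  have hew : QuadraticMap.polar (latticeForm ϖ n) e w = 1 := by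
    rw [polar_eq_of_apply hϖ g hge hw, hef]
  have hww : latticeForm ϖ n w = 0 := by rw [latticeForm_eq_of_apply hϖ g hw, hf]
  have hes : QuadraticMap.polar (latticeForm ϖ n) e (w - f) = 0 := by
    rw [QuadraticMap.polar_sub_right, hew, hef, sub_self]
  have hes' : QuadraticMap.polar (latticeForm ϖ n) e (-(w - f)) = 0 := by
    rw [QuadraticMap.polar_neg_right, hes, neg_zero]
  have hinv : latticeEichler hϖ he hes * latticeEichler hϖ he hes' = 1 :=
    mul_eq_one_comm.mp (latticeEichler_neg_mul hϖ he hes hes')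
  have hEf : (latticeEichler hϖ he hes : (Idx n → F) ≃ₗ[F] (Idx n → F)) (latticeEmb hϖ n f) =
      latticeEmb hϖ n w := by
    rw [latticeEichler_apply, eichler_apply, hef]
    congr 1
    have h1 : QuadraticMap.polar (latticeForm ϖ n) (w - f) f =
        QuadraticMap.polar (latticeForm ϖ n) w f := by
      rw [QuadraticMap.polar_sub_left, QuadraticMap.polar_self, hf, smul_zero, sub_zero]
    have h2 : latticeForm ϖ n (w - f) = -QuadraticMap.polar (latticeForm ϖ n) w f := by
      rw [sub_eq_add_neg, QuadraticMap.map_add (latticeForm ϖ n), QuadraticMap.map_neg, hww, hf,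
        QuadraticMap.polar_neg_right]
      ring
    rw [h1, h2]
    module
  refine (hasSpinorParity_latticeEichler hϖ he hes).of_mul hinv (ih _ ⟨?_, fun c hc => ?_⟩)
  · exact (hasSpinorParity_latticeEichler hϖ he hes').isIntegral.mul hg.1
  · rw [Subgroup.coe_mul, LinearEquiv.mul_apply]
    by_cases hci : (Sum.elim id id c : Fin n) = i
    · rcases c with c | c
      · obtain rfl : c = i := hci
        rw [hge]
        exact latticeEichler_apply_of_orthogonal hϖ he hes' (by
          rw [QuadraticMap.polar_self, he, smul_zero]) (by rw [QuadraticMap.polar_comm, hes'])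
      · obtain rfl : c = i := hci
        rw [hw, ← hEf, ← LinearEquiv.mul_apply, ← Subgroup.coe_mul, latticeEichler_neg_mul]
        rfl
    · have hlt : (i : ℕ) + 1 ≤ (Sum.elim id id c : Fin n) :=
        Nat.lt_of_le_of_ne hc fun h => hci (Fin.ext h.symm)
      have hd : ∀ d : Fin n ⊕ Fin n, Sum.elim id id d = i → QuadraticMap.polar (latticeForm ϖ n)
          (isotropicVector F d) (isotropicVector F c) = 0 := fun d hd => by
        rw [polar_isotropicVector, isotropicVector_inl, if_neg]
        rintro rfl
        exact hci (by rcases c with c | c <;> exact hd)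
      rw [hg.2 c hlt]
      refine latticeEichler_apply_of_orthogonal hϖ he hes' (hd _ rfl) ?_
      rw [QuadraticMap.polar_neg_left, QuadraticMap.polar_sub_left,
        polar_eq_of_apply hϖ g hw (hg.2 c hlt), sub_self, neg_zero]

/-- If `u = g e_i` satisfies `⟨u, e_i⟩ ∈ 𝒪ˣ`, then `q'(u - e_i) = -⟨u, e_i⟩` is a unit and the
reflection along `u - e_i` brings `u` back to `e_i`. -/
theorem hasSpinorParity_of_isUnit_polar {ϖ : 𝒪[F]} (hϖ : Irreducible ϖ) {n : ℕ} (i : Fin n)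
    (ih : ∀ g : orthogonalGroup (splitForm F n), FixesFrom hϖ i g → HasSpinorParity hϖ g)
    {g : orthogonalGroup (splitForm F n)} (hg : FixesFrom hϖ (i + 1) g) {u : Idx n → 𝒪[F]}
    (hgu : (g : (Idx n → F) ≃ₗ[F] (Idx n → F)) (latticeEmb hϖ n (isotropicVector F (Sum.inl i))) =
      latticeEmb hϖ n u) (hu : IsUnit (u (Sum.inl (Sum.inr i)))) : HasSpinorParity hϖ g := by
  set e := isotropicVector F (Sum.inl i) with he_def
  have he : latticeForm ϖ n e = 0 := latticeForm_isotropicVector ϖ _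
  have huu : latticeForm ϖ n u = 0 := by rw [latticeForm_eq_of_apply hϖ g hgu, he]
  have hue : QuadraticMap.polar (latticeForm ϖ n) u e = u (Sum.inl (Sum.inr i)) :=
    polar_isotropicVector ϖ u _
  have hx : latticeForm ϖ n (u - e) = -u (Sum.inl (Sum.inr i)) := by
    rw [sub_eq_add_neg, QuadraticMap.map_add (latticeForm ϖ n), QuadraticMap.map_neg, huu, he,
      QuadraticMap.polar_neg_right, hue]
    ring
  have hxu : IsUnit (latticeForm ϖ n (u - e)) := by rw [hx]; exact hu.neg
  refine (hasSpinorParity_latticeReflection hϖ hxu).of_mul (latticeReflection_mul_self hϖ _)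
    (hasSpinorParity_of_apply_e_eq hϖ i ih ⟨?_, fun c hc => ?_⟩ ?_)
  · exact (hasSpinorParity_latticeReflection hϖ hxu).isIntegral.mul hg.1
  · rw [Subgroup.coe_mul, LinearEquiv.mul_apply, hg.2 c hc]
    refine latticeReflection_apply_of_orthogonal hϖ _ ?_
    rw [QuadraticMap.polar_sub_left, polar_eq_of_apply hϖ g hgu (hg.2 c hc), sub_self]
  · rw [Subgroup.coe_mul, LinearEquiv.mul_apply, hgu,
      latticeReflection_apply hϖ _ (a := 1), one_smul, sub_sub_cancel]
    rw [mul_one, hx, QuadraticMap.polar_sub_left, QuadraticMap.polar_self, huu,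
      QuadraticMap.polar_comm, hue, smul_zero, zero_sub]

/-- Some coordinate of `u = g e_i` along the `e_j`, `f'_j` with `j ≤ i` is a unit, because
`⟨u, g f'_i⟩ = 1` while `⟨v'₀, v'₀⟩ = 2ϖ` is not a unit. A reflection or an Eichler transformation
moves this unit to the coordinate along `f'_i`. -/
theorem hasSpinorParity_of_fixesFrom_succ {ϖ : 𝒪[F]} (hϖ : Irreducible ϖ) {n : ℕ} (i : Fin n)
    (ih : ∀ g : orthogonalGroup (splitForm F n), FixesFrom hϖ i g → HasSpinorParity hϖ g)
    {g : orthogonalGroup (splitForm F n)} (hg : FixesFrom hϖ (i + 1) g) :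
    HasSpinorParity hϖ g := by
  set e := isotropicVector F (Sum.inl i) with he_def
  set f := isotropicVector F (Sum.inr i) with hf_def
  have he : latticeForm ϖ n e = 0 := latticeForm_isotropicVector ϖ _
  have hf : latticeForm ϖ n f = 0 := latticeForm_isotropicVector ϖ _
  have hef : QuadraticMap.polar (latticeForm ϖ n) e f = 1 := by
    rw [hf_def, polar_isotropicVector, he_def, isotropicVector_inl]; simp
  obtain ⟨u, hu⟩ := hg.1 e
  obtain ⟨w, hw⟩ := hg.1 f
  have huw : QuadraticMap.polar (latticeForm ϖ n) u w = 1 := by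
    rw [polar_eq_of_apply hϖ g hu hw, hef]
  have hperp : ∀ c d : Fin n ⊕ Fin n, (i : ℕ) + 1 ≤ (Sum.elim id id c : Fin n) →
      ((Sum.elim id id d : Fin n) : ℕ) ≤ i →
      QuadraticMap.polar (latticeForm ϖ n) (isotropicVector F d) (isotropicVector F c) = 0 := by
    intro c d hc hd
    rw [polar_isotropicVector, isotropicVector_inl, if_neg]
    rintro rfl
    rcases c with c | c <;> exact absurd (hc.trans hd) (Nat.not_succ_le_self _)
  by_cases hfu : IsUnit (u (Sum.inl (Sum.inr i)))
  · exact hasSpinorParity_of_isUnit_polar hϖ i ih hg hu hfu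
  have hex : ∃ c : Fin n ⊕ Fin n, IsUnit (u (Sum.inl c)) := by
    by_contra hno
    push Not at hno
    have hm : ∀ c, u (Sum.inl c) ∈ IsLocalRing.maximalIdeal 𝒪[F] := fun c =>
      (IsLocalRing.mem_maximalIdeal _).mpr (hno c)
    have hϖm : ϖ ∈ IsLocalRing.maximalIdeal 𝒪[F] :=
      (IsLocalRing.mem_maximalIdeal _).mpr hϖ.not_isUnit
    refine (Ideal.ne_top_iff_one _).mp (IsLocalRing.maximalIdeal.isMaximal 𝒪[F]).ne_top ?_
    rw [← huw, polar_latticeForm, polar_hyperbolicForm]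
    refine add_mem (sum_mem fun j _ => add_mem ?_ ?_) ?_
    · exact Ideal.mul_mem_right _ _ (hm _)
    · exact Ideal.mul_mem_right _ _ (hm _)
    · exact Ideal.mul_mem_right _ _ (Ideal.mul_mem_left _ _ hϖm)
  obtain ⟨c, hc⟩ := hex
  have hci : ((Sum.elim id id c : Fin n) : ℕ) ≤ i := by
    by_contra hlt
    have hlt' : (i : ℕ) + 1 ≤ (Sum.elim id id c.swap : Fin n) := by
      rcases c with c | c <;> exact not_le.mp hlt
    have h1 := polar_eq_of_apply hϖ g hu (hg.2 c.swap hlt')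
    rw [hperp c.swap (Sum.inl i) hlt' le_rfl, polar_isotropicVector, Sum.swap_swap] at h1
    exact not_isUnit_zero (h1 ▸ hc)
  by_cases hce : c = Sum.inl i
    -- The reflection along `e_i - f'_i` exchanges `e_i` and `f'_i`.
  · have hx : latticeForm ϖ n (e - f) = -1 := by
      rw [sub_eq_add_neg, QuadraticMap.map_add (latticeForm ϖ n), QuadraticMap.map_neg, he, hf,
        QuadraticMap.polar_neg_right, hef]
      ring
    have hxu : IsUnit (latticeForm ϖ n (e - f)) := by rw [hx]; exact isUnit_one.neg
    have hpu : QuadraticMap.polar (latticeForm ϖ n) (e - f) u =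
        latticeForm ϖ n (e - f) * (u (Sum.inl (Sum.inl i)) - u (Sum.inl (Sum.inr i))) := by
      rw [QuadraticMap.polar_comm, QuadraticMap.polar_sub_right, hx, he_def, hf_def,
        polar_isotropicVector, polar_isotropicVector]
      simp
    refine (hasSpinorParity_latticeReflection hϖ hxu).of_mul (latticeReflection_mul_self hϖ _)
      (hasSpinorParity_of_isUnit_polar hϖ i ih ⟨?_, fun d hd => ?_⟩
        (by rw [Subgroup.coe_mul, LinearEquiv.mul_apply, hu, latticeReflection_apply hϖ _ hpu]) ?_)
    · exact (hasSpinorParity_latticeReflection hϖ hxu).isIntegral.mul hg.1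
    · rw [Subgroup.coe_mul, LinearEquiv.mul_apply, hg.2 d hd]
      refine latticeReflection_apply_of_orthogonal hϖ _ ?_
      rw [QuadraticMap.polar_sub_left, hperp d _ hd le_rfl, hperp d _ hd le_rfl, sub_self]
    · rw [hce] at hc
      simpa [he_def, hf_def, isotropicVector_inl] using hc
  · have hcf : c ≠ Sum.inr i := by
      rintro rfl
      exact hfu hc
    have hne : Sum.elim id id c ≠ i := by
      rcases c with c | c
      · exact fun h => hce (congrArg Sum.inl h)
      · exact fun h => hcf (congrArg Sum.inr h)
    -- Adding to `u` the multiple `⟨u, p⟩ f'_i` for `p` dual to `c` makes the coordinate a unit.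
    set p := isotropicVector F c.swap with hp_def
    have hp : latticeForm ϖ n p = 0 := latticeForm_isotropicVector ϖ _
    have hpf : QuadraticMap.polar (latticeForm ϖ n) p f = 0 := by
      rw [hf_def, polar_isotropicVector, hp_def, isotropicVector_inl, if_neg]
      rcases c with c | c
      · simp
      · simpa using fun h => hne h.symm
    have hpf' : QuadraticMap.polar (latticeForm ϖ n) p (-f) = 0 := by
      rw [QuadraticMap.polar_neg_right, hpf, neg_zero]
    have hpu : QuadraticMap.polar (latticeForm ϖ n) p u = u (Sum.inl c) := by
      rw [QuadraticMap.polar_comm, hp_def, polar_isotropicVector, Sum.swap_swap]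
    have hci' : ((Sum.elim id id c.swap : Fin n) : ℕ) ≤ i := by
      rcases c with c | c <;> exact hci
    refine (hasSpinorParity_latticeEichler hϖ hp hpf').of_mul
      (latticeEichler_neg_mul hϖ hp hpf hpf')
      (hasSpinorParity_of_isUnit_polar hϖ i ih ⟨?_, fun d hd => ?_⟩
        (by rw [Subgroup.coe_mul, LinearEquiv.mul_apply, hu, latticeEichler_apply]) ?_)
    · exact (hasSpinorParity_latticeEichler hϖ hp hpf).isIntegral.mul hg.1
    · rw [Subgroup.coe_mul, LinearEquiv.mul_apply, hg.2 d hd]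
      exact latticeEichler_apply_of_orthogonal hϖ hp hpf (hperp d _ hd hci') (hperp d _ hd le_rfl)
    · have hpi : p (Sum.inl (Sum.inr i)) = 0 := by
        rw [hp_def, isotropicVector_inl, if_neg]
        rcases c with c | c
        · simpa using fun h => hne h.symm
        · simp
      have hfi : f (Sum.inl (Sum.inr i)) = 1 := by simp [hf_def, isotropicVector_inl]
      rw [eichler_apply, hpu]
      simp only [Pi.add_apply, Pi.sub_apply, Pi.smul_apply, hpi, hfi, smul_eq_mul, mul_one,
        mul_zero, sub_zero]
      by_contra hno
      refine IsLocalRing.nonunits_add hno (b := -u (Sum.inl (Sum.inr i)))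
        (fun h => hfu (by simpa using h.neg)) ?_
      rwa [add_neg_cancel_comm]

/-- The formula holds for every isometry preserving the lattice, of determinant `1` or `-1`. -/
theorem IsIntegral.hasSpinorParity {ϖ : 𝒪[F]} {hϖ : Irreducible ϖ} {n : ℕ}
    {g : orthogonalGroup (splitForm F n)} (hg : IsIntegral hϖ g) : HasSpinorParity hϖ g := by
  have key : ∀ m : ℕ, m ≤ n → ∀ g : orthogonalGroup (splitForm F n), FixesFrom hϖ m g →
      HasSpinorParity hϖ g := by
    intro m
    induction m with
    | zero => exact fun _ g hg => hasSpinorParity_of_fixesFrom_zero hϖ hg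
    | succ m ih => exact fun hm g hg =>
        hasSpinorParity_of_fixesFrom_succ hϖ ⟨m, hm⟩ (ih (Nat.le_of_succ_le hm)) hg
  exact key n le_rfl g ⟨hg, fun c hc => absurd hc (not_le.mpr (Fin.is_lt _))⟩

/-! ### The character `η ∘ ν` on `J` -/

theorem etaSpinorNorm_eq_signDet {ϖ : 𝒪[F]} (hϖ : Irreducible ϖ) {n : ℕ} (g : epiparamodular F n) :
    etaSpinorNorm F n g = signDet (hyperbolicForm 𝓀[F] n) (reduction hϖ n g) := by
  have hr := reduces_reduction hϖ g
  obtain ⟨h, hr', hp⟩ := hr.isIntegral.hasSpinorParity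
  rw [hr.unique hr', hp.signDet_eq]
  rfl

theorem det_latticeReflection {ϖ : 𝒪[F]} (hϖ : Irreducible ϖ) {n : ℕ} {x : Idx n → 𝒪[F]}
    (hx : latticeForm ϖ n x ≠ 0) :
    LinearEquiv.det (latticeReflection hϖ hx : (Idx n → F) ≃ₗ[F] (Idx n → F)) = -1 :=
  Units.ext (det_reflection _)

/-- The product of the reflections along `e_i + f'_i` and `v'₀` lies in `J`, and `η ∘ ν`
takes the value `-1` on it. -/
theorem exists_etaSpinorNorm_eq_neg_one {ϖ : 𝒪[F]} (hϖ : Irreducible ϖ) {n : ℕ} (i : Fin n) :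
    ∃ g : epiparamodular F n, etaSpinorNorm F n g = -1 := by
  set x : Idx n → 𝒪[F] := isotropicVector F (Sum.inl i) + isotropicVector F (Sum.inr i) with hx_def
  have hx : IsUnit (latticeForm ϖ n x) := by
    rw [hx_def, QuadraticMap.map_add (latticeForm ϖ n), latticeForm_isotropicVector,
      latticeForm_isotropicVector, polar_isotropicVector, isotropicVector_inl]
    simp
  set s := latticeReflection hϖ hx.ne_zero
  set t := latticeReflection hϖ (latticeForm_centralVector_ne_zero hϖ n)
  have hs : HasSpinorParity hϖ s := hasSpinorParity_latticeReflection hϖ hx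
  have ht : HasSpinorParity hϖ t := hasSpinorParity_centralVector hϖ n
  have hts : (t * s) * (s * t) = 1 := by
    rw [mul_assoc, ← mul_assoc s, latticeReflection_mul_self, one_mul, latticeReflection_mul_self]
  have hmem : ∀ g : orthogonalGroup (splitForm F n), IsIntegral hϖ g → ∀ v ∈ lattice F n,
      (g : (Idx n → F) ≃ₗ[F] (Idx n → F)) v ∈ lattice F n := by
    intro g hg v hv
    obtain ⟨y, rfl⟩ := (mem_lattice_iff_exists hϖ v).mp hv
    exact (mem_lattice_iff_exists hϖ _).mpr (hg y)
  let g : specialOrthogonalGroup (splitForm F n) := ⟨(s * t : orthogonalGroup _), (s * t).2, by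
    change LinearEquiv.det ((s * t : orthogonalGroup _) : (Idx n → F) ≃ₗ[F] (Idx n → F)) = 1
    rw [Subgroup.coe_mul, map_mul, det_latticeReflection, det_latticeReflection,
      neg_mul_neg, one_mul]⟩
  refine ⟨⟨g, fun v => ⟨fun hv => ?_, hmem _ (hs.isIntegral.mul ht.isIntegral) v⟩⟩, ?_⟩
  · have h1 := hmem _ (ht.isIntegral.mul hs.isIntegral) _ hv
    have h2 : ((t * s : orthogonalGroup _) : (Idx n → F) ≃ₗ[F] (Idx n → F))
        (((s * t : orthogonalGroup _) : (Idx n → F) ≃ₗ[F] (Idx n → F)) v) = v := by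
      rw [← LinearEquiv.mul_apply, ← Subgroup.coe_mul, hts]
      rfl
    exact h2 ▸ h1
  · change etaBar F (spinorNormO (splitForm F n) (splitForm_separatingLeft F n) (s * t)) = -1
    rw [map_mul, map_mul, eta_latticeReflection_of_isUnit hϖ hx,
      eta_latticeReflection_centralVector, mul_one]

end SpinorParity

end Paramodular

theorem mainTheorem3 {F : Type*} [Field F] [ValuativeRel F] [TopologicalSpace F]
    [IsNonarchimedeanLocalField F] [CharZero F] (n : ℕ) (ϖ : 𝒪[F]) (hϖ : Irreducible ϖ) :
    (1 < 2 * n + 1 →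
      Function.Surjective ((etaSpinorNorm F n).comp (epiparamodular F n).subtype)) ∧
    ((etaSpinorNorm F n).comp (epiparamodular F n).subtype).ker = paramodular hϖ n := by
  refine ⟨fun hn ε => ?_, ?_⟩
  · rcases Int.units_eq_one_or ε with rfl | rfl
    · exact ⟨1, map_one _⟩
    · exact exists_etaSpinorNorm_eq_neg_one hϖ ⟨0, by omega⟩
  · ext g
    rw [mem_paramodular_iff, ← etaSpinorNorm_eq_signDet, MonoidHom.mem_ker]
    rfl
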